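/- Manifolds are finite-dimensional, smooth, Hausdorff, second countable and without boundary. A smooth action of the multiplicative semigroup $(\mathbb{R}_{\ge 0},\cdot)$ on a manifold $M$ is a map $h:[0,\infty)\times M\to M$, $h_t=h(t,\cdot)$, with $h_{ts}=h_t\circ h_s$ for all $t,s\ge 0$, which extends to a smooth map $(-\varepsilon,\infty)\times M\to M$ for some $\varepsilon>0$; it is not assumed that $h_1=\mathrm{id}_M$. It is a homogeneity structure of degree $n$ if, for each $p\in M$, the following holds: the $n$-th jet at $0$ of the curve $t\mapsto h_t(p)$ vanishes (i.e. its derivatives at $0$ of orders $1,\dots,n$ in local coordinates are zero) if and only if $p\in h_0(M)$. For $\mathbf d=(d_1,\dots,d_n)$ let $\mathbb{R}^{\mathbf d}$ be $\mathbb{R}^{d_1+\dots+d_n}$ with the action of $(\mathbb{R}_{\ge 0},\cdot)$ that multiplies each of the $d_k$ coordinates of degree $k$ by $t^k$. A graded bundle of degree $n$ and rank $\mathbf d$ is a smooth fiber bundle $\pi:M\to M_0$ with an atlas of smooth local trivializations $\pi^{-1}(U)\to U\times\mathbb{R}^{\mathbf d}$ whose transition maps are, in each fiber, diffeomorphisms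 of $\mathbb{R}^{\mathbf d}$ commuting with that action. Its homotheties are the maps $M\to M$, indexed by $t\ge0$, that are given in these trivializations by the action on $\mathbb{R}^{\mathbf d}$. Morphisms of graded bundles are smooth maps of total spaces intertwining the homotheties. **Theorem.** Let $h:[0,\infty)\times M\to M$ be a smooth action of the semigroup $(\mathbb{R}_{\ge 0},\cdot)$ on a connected (non-empty) manifold $M$. 1. $h$ is a homogeneity structure of some degree $n\ge 1$ if and only if $h_1=\mathrm{id}_M$. 2. If $h$ is a homogeneity structure of degree $n\ge1$, then $M$ carries a structure of a graded bundle of degree $n$ whose homotheties are the maps $h_t$, $t\ge 0$. 3. If $h_1=\mathrm{id}_M$, then $h$ extends uniquely to a smooth action $\mathbb{R}\times M\to M$ of the multiplicative monoid $(\mathbb{R},\cdot)$. Moreover, the category of graded bundles (of arbitrary degree and rank) with connected total space and their morphisms is equivalent to the category of connected manifolds with a smooth action of the monoid $(\mathbb{R},\cdot)$ and smooth equivariant maps. The equivalence can be chosen so that, up to a natural diffeomorphism, it keeps the underlying manifolds and maps and extends the homotheties of each graded bundle to an action of $(\mathbb{R},\cdot)$. -/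

import Mathlib

open scoped Manifold ContDiff NNReal

universe u

/-! ### Smooth actions of the multiplicative reals -/

/-- A map `h : [0,∞) × M → M` is smooth if it is the restriction of a smooth map defined on
`(-ε,∞) × M` for some `ε > 0`. -/
def IsSmoothOnNNReal (m : ℕ) {M : Type u} [TopologicalSpace M]
    [ChartedSpace (EuclideanSpace ℝ (Fin m)) M] (h : ℝ≥0 → M → M) : Prop :=
  ∃ ε : ℝ, 0 < ε ∧ ∃ H : ℝ × M → M,
    ContMDiffOn (𝓘(ℝ, ℝ).prod (𝓡 m)) (𝓡 m) ∞ H (Set.Ioi (-ε) ×ˢ Set.univ) ∧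
    ∀ (t : ℝ≥0) (p : M), H ((t : ℝ), p) = h t p

/-- A smooth action of the multiplicative semigroup `(ℝ≥0, ·)`; it is *not* required that `1` acts
as the identity. -/
structure IsSmoothSemigroupAction (m : ℕ) {M : Type u} [TopologicalSpace M]
    [ChartedSpace (EuclideanSpace ℝ (Fin m)) M] (h : ℝ≥0 → M → M) : Prop where
  smooth : IsSmoothOnNNReal m h
  mul_act : ∀ (t s : ℝ≥0) (p : M), h (t * s) p = h t (h s p)

/-- A smooth action of the multiplicative monoid `(ℝ, ·)`. -/
structure IsSmoothRealAction (m : ℕ) {M : Type u} [TopologicalSpace M]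
    [ChartedSpace (EuclideanSpace ℝ (Fin m)) M] (H : ℝ → M → M) : Prop where
  smooth : ContMDiff (𝓘(ℝ, ℝ).prod (𝓡 m)) (𝓡 m) ∞ (fun x : ℝ × M => H x.1 x.2)
  one_act : ∀ p : M, H 1 p = p
  mul_act : ∀ (t s : ℝ) (p : M), H (t * s) p = H t (H s p)

/-- The `n`-th jet at `0` of a curve `α : [0,∞) → M` vanishes: in local coordinates around `α 0`,
all (one-sided) derivatives of orders `1, …, n` at `0` are zero. -/
def JetVanishes (m : ℕ) {M : Type u} [TopologicalSpace M]
    [ChartedSpace (EuclideanSpace ℝ (Fin m)) M] (n : ℕ) (α : ℝ≥0 → M) : Prop :=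
  ∀ i : ℕ, 1 ≤ i → i ≤ n →
    iteratedDerivWithin i
      (fun s : ℝ => chartAt (EuclideanSpace ℝ (Fin m)) (α 0) (α s.toNNReal)) (Set.Ici 0) 0 = 0

/-- A homogeneity structure of degree `n`: a smooth action of the semigroup `(ℝ≥0, ·)` such that
the `n`-th jet at `0` of `t ↦ h t p` vanishes if and only if `p ∈ h 0 (M)`. -/
structure IsHomogeneityStructure (m : ℕ) {M : Type u} [TopologicalSpace M]
    [ChartedSpace (EuclideanSpace ℝ (Fin m)) M] (n : ℕ) (h : ℝ≥0 → M → M) : Prop where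
  action : IsSmoothSemigroupAction m h
  nondegenerate : ∀ p : M, JetVanishes m n (fun t => h t p) ↔ p ∈ Set.range (h 0)

/-! ### Standard graded spaces -/

/-- The standard graded space of rank `d = (d₁, …, dₙ)`; its coordinates `y_{r,a}`, `1 ≤ a ≤ d_r`,
are indexed by pairs, where the index `r : Fin n` stands for the degree `r + 1`. -/
abbrev StdGradedSpace {n : ℕ} (d : Fin n → ℕ) : Type :=
  EuclideanSpace ℝ (Σ r : Fin n, Fin (d r))

/-- The standard homogeneity structure: a coordinate of degree `k` is multiplied by `t ^ k`. -/
def stdHomothety {n : ℕ} (d : Fin n → ℕ) (t : ℝ≥0) (y : StdGradedSpace d) : StdGradedSpace d :=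
  WithLp.toLp 2 fun i => (t : ℝ) ^ ((i.1 : ℕ) + 1) * y i

/-- Automorphisms of the standard graded space: diffeomorphisms which intertwine the action. -/
structure StdGradedAut {n : ℕ} (d : Fin n → ℕ) where
  toDiffeo : Diffeomorph 𝓘(ℝ, StdGradedSpace d) 𝓘(ℝ, StdGradedSpace d)
    (StdGradedSpace d) (StdGradedSpace d) ∞
  map_homothety : ∀ (t : ℝ≥0) (y : StdGradedSpace d),
    toDiffeo (stdHomothety d t y) = stdHomothety d t (toDiffeo y)

/-! ### Graded bundles -/

/-- A structure of a graded bundle of degree `n` on a manifold `M`: a smooth projection onto a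
manifold together with an atlas of smooth local trivializations whose typical fiber is a standard
graded space and whose transition maps are, in each fiber, automorphisms of that graded space. -/
structure GradedBundle (n m : ℕ) (M : Type u) [TopologicalSpace M]
    [ChartedSpace (EuclideanSpace ℝ (Fin m)) M] where
  baseDim : ℕ
  Base : Type u
  [topBase : TopologicalSpace Base]
  [chartedBase : ChartedSpace (EuclideanSpace ℝ (Fin baseDim)) Base]
  [manifoldBase : IsManifold (𝓡 baseDim) ∞ Base]
  [t2Base : T2Space Base]
  [secondCountableBase : SecondCountableTopology Base]
  proj : M → Base
  smooth_proj : ContMDiff (𝓡 m) (𝓡 baseDim) ∞ proj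
  rank : Fin n → ℕ
  atlas : Set (Bundle.Trivialization (StdGradedSpace rank) proj)
  covers : ∀ b : Base, ∃ e ∈ atlas, b ∈ e.baseSet
  smooth_triv : ∀ e ∈ atlas,
    ContMDiffOn (𝓡 m) ((𝓡 baseDim).prod 𝓘(ℝ, StdGradedSpace rank)) ∞ e e.source
  smooth_triv_symm : ∀ e ∈ atlas,
    ContMDiffOn ((𝓡 baseDim).prod 𝓘(ℝ, StdGradedSpace rank)) (𝓡 m) ∞
      e.toOpenPartialHomeomorph.symm e.target
  transition : ∀ e ∈ atlas, ∀ e' ∈ atlas, ∀ b ∈ e.baseSet ∩ e'.baseSet,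
    ∃ g : StdGradedAut rank, ∀ y : StdGradedSpace rank,
      e' (e.toOpenPartialHomeomorph.symm (b, y)) = (b, g.toDiffeo y)

namespace GradedBundle

variable {n m : ℕ} {M : Type u} [TopologicalSpace M] [ChartedSpace (EuclideanSpace ℝ (Fin m)) M]

attribute [instance] topBase chartedBase manifoldBase t2Base secondCountableBase

/-- The homotheties of a graded bundle: in a local trivialization around the fiber of `p` they are
the homotheties of the typical fiber. -/
noncomputable def homothety (E : GradedBundle n m M) (t : ℝ≥0) (p : M) : M :=
  (E.covers (E.proj p)).choose.toOpenPartialHomeomorph.symm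
    (E.proj p, stdHomothety E.rank t ((E.covers (E.proj p)).choose p).2)

/-- The homotheties do not depend on the local trivialization. -/
theorem homothety_eq (E : GradedBundle n m M) (e : Bundle.Trivialization (StdGradedSpace E.rank) E.proj)
    (he : e ∈ E.atlas) (t : ℝ≥0) (p : M) (hp : E.proj p ∈ e.baseSet) :
    e (E.homothety t p) = (E.proj p, stdHomothety E.rank t (e p).2) := by
  obtain ⟨hc, hb⟩ := (E.covers (E.proj p)).choose_spec
  obtain ⟨g, hg⟩ := E.transition _ hc e he (E.proj p) ⟨hb, hp⟩
  unfold homothety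
  rw [hg, g.map_homothety]
  have h1 := hg ((E.covers (E.proj p)).choose p).2
  rw [Bundle.Trivialization.symm_apply_mk_proj _
    ((Bundle.Trivialization.mem_source _).2 hb)] at h1
  rw [h1]

end GradedBundle

/-! ### The two categories -/

/-- An object of the category of graded bundles: a graded bundle of some degree and rank over a
connected manifold. -/
structure GradedBundleCat : Type (u + 1) where
  dim : ℕ
  Carrier : Type u
  [top : TopologicalSpace Carrier]
  [charted : ChartedSpace (EuclideanSpace ℝ (Fin dim)) Carrier]
  [manifold : IsManifold (𝓡 dim) ∞ Carrier]
  [t2 : T2Space Carrier]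
  [secondCountable : SecondCountableTopology Carrier]
  [connected : ConnectedSpace Carrier]
  degree : ℕ
  bundle : GradedBundle degree dim Carrier

namespace GradedBundleCat

attribute [instance] top charted manifold t2 secondCountable connected

/-- Morphisms of graded bundles: smooth maps which intertwine the homotheties. -/
@[ext]
structure Hom (X Y : GradedBundleCat.{u}) where
  toFun : X.Carrier → Y.Carrier
  smooth : ContMDiff (𝓡 X.dim) (𝓡 Y.dim) ∞ toFun
  map_homothety : ∀ (t : ℝ≥0) (p : X.Carrier),
    toFun (X.bundle.homothety t p) = Y.bundle.homothety t (toFun p)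

instance : CategoryTheory.Category GradedBundleCat.{u} where
  Hom := Hom
  id X := ⟨id, contMDiff_id, fun _ _ => rfl⟩
  comp f g := ⟨g.toFun ∘ f.toFun, g.smooth.comp f.smooth, fun t p => by
    simp only [Function.comp_apply, f.map_homothety, g.map_homothety]⟩

end GradedBundleCat

/-- An object of the category of `(ℝ, ·)`-manifolds: a connected manifold with a smooth action of
the multiplicative monoid of reals. -/
structure RealActionManifold : Type (u + 1) where
  dim : ℕ
  Carrier : Type u
  [top : TopologicalSpace Carrier]
  [charted : ChartedSpace (EuclideanSpace ℝ (Fin dim)) Carrier]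
  [manifold : IsManifold (𝓡 dim) ∞ Carrier]
  [t2 : T2Space Carrier]
  [secondCountable : SecondCountableTopology Carrier]
  [connected : ConnectedSpace Carrier]
  act : ℝ → Carrier → Carrier
  isSmoothRealAction : IsSmoothRealAction dim act

namespace RealActionManifold

attribute [instance] top charted manifold t2 secondCountable connected

/-- Morphisms of `(ℝ, ·)`-manifolds: smooth equivariant maps. -/
@[ext]
structure Hom (X Y : RealActionManifold.{u}) where
  toFun : X.Carrier → Y.Carrier
  smooth : ContMDiff (𝓡 X.dim) (𝓡 Y.dim) ∞ toFun
  map_act : ∀ (t : ℝ) (p : X.Carrier), toFun (X.act t p) = Y.act t (toFun p)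

instance : CategoryTheory.Category RealActionManifold.{u} where
  Hom := Hom
  id X := ⟨id, contMDiff_id, fun _ _ => rfl⟩
  comp f g := ⟨g.toFun ∘ f.toFun, g.smooth.comp f.smooth, fun t p => by
    simp only [Function.comp_apply, f.map_act, g.map_act]⟩

end RealActionManifold

/-- A functor from graded bundles to `(ℝ, ·)`-manifolds *extends the homotheties* if, up to a
natural diffeomorphism, it keeps the underlying manifolds and maps, and the action of `(ℝ, ·)` on
the image of a graded bundle restricts to the homotheties of that bundle. -/
def ExtendsHomotheties
    (F : CategoryTheory.Functor GradedBundleCat.{u} RealActionManifold.{u}) : Prop :=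
  ∃ η : ∀ X : GradedBundleCat.{u},
      Diffeomorph (𝓡 X.dim) (𝓡 (F.obj X).dim) X.Carrier (F.obj X).Carrier ∞,
    (∀ (X : GradedBundleCat.{u}) (t : ℝ≥0) (p : X.Carrier),
      η X (X.bundle.homothety t p) = (F.obj X).act (t : ℝ) (η X p)) ∧
    (∀ (X Y : GradedBundleCat.{u}) (f : X ⟶ Y) (p : X.Carrier),
      η Y (GradedBundleCat.Hom.toFun f p) =
        RealActionManifold.Hom.toFun (F.map f) (η X p))

/-!
The proof rests on *homogeneous charts*: charts `Ψ : M → ι → ℝ`, defined on a union of fibers of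
`h 0`, in which `h t` multiplies the `i`-th coordinate by `t ^ w i` with weights `w i : ℕ`.

*Existence* (`IsSmoothSemigroupAction.isLocallyGraded`). If `h 1` is the identity, then
`g t = h (t ^ 2)` is a smooth action of all of `(ℝ, ·)`. The components of the Taylor coefficients at
`t = 0` of the orbits `t ↦ g t p`, read in a chart around a fixed point `q`, are homogeneous functions
of `p`. Their differentials at `q` span the cotangent space: a tangent vector killed by all of them has
a flat orbit under the linearized action, and such an orbit vanishes (`eq_zero_of_flat_orbit`). So some
of these functions are coordinates near `q`, and contracting by `g s` with `s` small shows that they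
are coordinates on all the fibers of `g 0` near `q` (`exists_saturated_chart`). Since `g (-1)` is the
identity, their degrees are even; halving them gives the weights for `h`.

*Consequences.* On a connected manifold the weights do not depend on the chart
(`IsLocallyGraded.exists_weightMultiset`), since `d (h 2)` at a fixed point has the eigenvalues
`2 ^ w i`. The coordinates of weight zero are charts of the set `h 0 (M)`, those of positive weight are
fiber coordinates, and this is a graded bundle (`HasGradedAtlas.toGradedBundle`). The `n`-jet of the
orbit of a point consists of its coordinates of weights `1, …, n` (`HomogeneousChart.jetVanishes_iff`).
Hence `h` is a homogeneity structure of degree `n` as soon as `n` bounds the weights, and conversely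
the weights of a homogeneity structure of degree `n` are at most `n`.

*Homogeneity structures satisfy `h 1 = id`* (`IsHomogeneityStructure.one_act`). The map `h 1` is
idempotent, and by the condition on jets its fiber over a point of `h 0 (M)` is that single point. So
near this point `h 1` is the identity, and the set of points near which it is the identity is open and
closed.

*Extension to `(ℝ, ·)`*. In homogeneous charts the formula `t ^ w i` makes sense for all real `t`. A
smooth curve which is an orbit of `h` for `t ≥ 0`, and another one for `t ≤ 0`, has in a homogeneous
chart coordinates which are monomials on either side of `0`, and smoothness forces them to be one
monomial (`eq_neg_one_pow_mul_of_contDiffAt`). So such a curve is determined by its value at `1`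
(`IsLocallyGraded.curve_ext`). This gives the independence of the chart, the uniqueness of the
extension, and the equivariance of morphisms of graded bundles for the extended actions, that is, a
fully faithful functor. It is essentially surjective because the restriction of an action of `(ℝ, ·)`
to `(ℝ≥0, ·)` comes from a graded bundle.
-/

open Filter Topology Asymptotics Set

/-! ### Jets of smooth curves and partial derivatives -/

section Calculus

variable {E G : Type*} [NormedAddCommGroup E] [NormedSpace ℝ E]
  [NormedAddCommGroup G] [NormedSpace ℝ G]

theorem taylor_isLittleO_at_zero {c : ℝ → G} (hc : ContDiffAt ℝ ∞ c 0) (n : ℕ) :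
    (fun s => c s - ∑ k ∈ Finset.range (n + 1),
      (((k.factorial : ℝ))⁻¹ * s ^ k) • iteratedDeriv k c 0) =o[𝓝 0] fun s : ℝ => s ^ n := by
  obtain ⟨u, hu, hcu⟩ := (hc.of_le (by exact_mod_cast le_top : ((n : ℕ) : WithTop ℕ∞) ≤ ∞)).contDiffOn
    le_rfl (by simp)
  obtain ⟨r, hr, hru⟩ := Metric.mem_nhds_iff.1 hu
  have h0 : (0 : ℝ) ∈ Metric.ball (0 : ℝ) r := Metric.mem_ball_self hr
  have h := taylor_isLittleO (convex_ball (0 : ℝ) r) h0 (hcu.mono hru)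
  rw [Metric.isOpen_ball.nhdsWithin_eq h0] at h
  refine (h.congr_left fun s => ?_).congr_right fun s => by simp
  rw [taylor_within_apply]
  congr 1
  refine Finset.sum_congr rfl fun k hk => ?_
  rw [iteratedDerivWithin_eq_iteratedDeriv (Metric.isOpen_ball.uniqueDiffOn)
    (hc.of_le (by exact_mod_cast le_top)) h0, sub_zero]

theorem eq_zero_of_const_smul_pow_isLittleO {a : G} {n : ℕ}
    (h : (fun s : ℝ => s ^ n • a) =o[𝓝[>] 0] fun s : ℝ => s ^ n) : a = 0 := by
  have h1 : (fun _ : ℝ => a) =o[𝓝[>] 0] fun _ : ℝ => (1 : ℝ) := by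
    rw [isLittleO_iff] at h ⊢
    intro C hC
    filter_upwards [h hC, self_mem_nhdsWithin] with s hs hs0
    have : 0 < |s ^ n| := abs_pos.2 (pow_pos hs0 n).ne'
    rw [norm_smul, Real.norm_eq_abs, mul_comm] at hs
    simpa using le_of_mul_le_mul_right hs this
  rw [isLittleO_one_iff] at h1
  exact tendsto_nhds_unique tendsto_const_nhds h1

/-- The `n`-jet at `0` of a smooth curve vanishes if and only if the curve is constant up to
`o(s ^ n)`. -/
theorem iteratedDeriv_eq_zero_iff_isLittleO {c : ℝ → G} (hc : ContDiffAt ℝ ∞ c 0) (n : ℕ) :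
    (∀ i, 1 ≤ i → i ≤ n → iteratedDeriv i c 0 = 0) ↔
      (fun s => c s - c 0) =o[𝓝[>] 0] fun s : ℝ => s ^ n := by
  have key : ∀ n, (∀ i, 1 ≤ i → i ≤ n → iteratedDeriv i c 0 = 0) →
      (fun s => c s - c 0) =o[𝓝 0] fun s : ℝ => s ^ n := by
    intro n h
    refine (taylor_isLittleO_at_zero hc n).congr_left fun s => ?_
    rw [Finset.sum_range_succ', Finset.sum_eq_zero]
    · simp
    · intro k hk
      rw [h (k + 1) (by omega) (by have := Finset.mem_range.1 hk; omega), smul_zero]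
  refine ⟨fun h => (key n h).mono nhdsWithin_le_nhds, fun h i => ?_⟩
  induction i using Nat.strong_induction_on with
  | _ i ih =>
    intro hi hin
    have h1 := (taylor_isLittleO_at_zero hc i).mono (nhdsWithin_le_nhds (s := Ioi 0))
    have h2 : (fun s => c s - c 0) =o[𝓝[>] 0] fun s : ℝ => s ^ i :=
      h.trans_isBigO (by
        have : ∀ᶠ s : ℝ in 𝓝[>] 0, s < 1 := nhdsWithin_le_nhds (Iio_mem_nhds one_pos)
        refine IsBigO.of_bound 1 ?_
        filter_upwards [this, self_mem_nhdsWithin] with s hs hs0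
        have hs0 : 0 < s := hs0
        rw [one_mul, Real.norm_of_nonneg (by positivity), Real.norm_of_nonneg (by positivity)]
        exact pow_le_pow_of_le_one hs0.le hs.le hin)
    have h3 := h2.sub h1
    have h4 : (fun s : ℝ => s ^ i • (((i.factorial : ℝ))⁻¹ • iteratedDeriv i c 0)) =o[𝓝[>] 0]
        fun s : ℝ => s ^ i := by
      refine h3.congr_left fun s => ?_
      obtain ⟨j, rfl⟩ : ∃ j, i = j + 1 := ⟨i - 1, by omega⟩
      rw [Finset.sum_range_succ, Finset.sum_range_succ', Finset.sum_eq_zero]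
      · simp [smul_smul, mul_comm]
      · intro k hk
        have := Finset.mem_range.1 hk
        rw [ih (k + 1) (by omega) (by omega) (by omega), smul_zero]
    have h5 := eq_zero_of_const_smul_pow_isLittleO h4
    rwa [smul_eq_zero_iff_right (by positivity)] at h5

theorem iteratedDeriv_comp_mul_left (f : ℝ → G) (a : ℝ) (k : ℕ) :
    iteratedDeriv k (fun x => f (a * x)) = fun x => a ^ k • iteratedDeriv k f (a * x) := by
  induction k with
  | zero => simp
  | succ k ih =>
    funext x
    rw [iteratedDeriv_succ, ih, deriv_fun_const_smul_field, iteratedDeriv_succ,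
      deriv_comp_mul_left a (iteratedDeriv k f) x, smul_smul, pow_succ]

/-- A smooth curve which is a monomial of degree `k` on either side of `0` is a monomial. -/
theorem eq_neg_one_pow_mul_of_contDiffAt {f : ℝ → ℝ} (hf : ContDiffAt ℝ ∞ f 0) {a b : ℝ} {k : ℕ}
    (hpos : ∀ t, 0 ≤ t → f t = t ^ k * a) (hneg : ∀ t, 0 ≤ t → f (-t) = t ^ k * b) :
    b = (-1) ^ k * a := by
  have hg : ContDiffAt ℝ ∞ (fun t => f t - t ^ k * a) 0 := by fun_prop
  have h1 := (iteratedDeriv_eq_zero_iff_isLittleO hg k).2 (by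
    refine (isLittleO_zero _ _).congr' ?_ EventuallyEq.rfl
    filter_upwards [self_mem_nhdsWithin] with s hs
    simp [hpos s (le_of_lt hs), hpos 0 le_rfl])
  have hg' : ContDiffAt ℝ ∞ (fun t => f (-1 * t) - (-1 * t) ^ k * a) 0 := by
    have : ContDiffAt ℝ ∞ (fun t => f t - t ^ k * a) ((-1 : ℝ) * 0) := by simpa using hg
    exact this.comp (0 : ℝ) (contDiffAt_const.mul contDiffAt_id)
  have h2 := (iteratedDeriv_eq_zero_iff_isLittleO hg' k).1 (by
    intro i hi hik
    rw [iteratedDeriv_comp_mul_left (fun t => f t - t ^ k * a) (-1) i]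
    simp [h1 i hi hik])
  have h3 := eq_zero_of_const_smul_pow_isLittleO (n := k) (a := b - (-1) ^ k * a) (by
    refine h2.congr' ?_ EventuallyEq.rfl
    filter_upwards [self_mem_nhdsWithin] with s hs
    have e1 := hneg s (le_of_lt hs)
    have e2 := hpos 0 le_rfl
    simp only [mul_zero, neg_one_mul, smul_eq_mul, e1, e2]
    rw [neg_pow s]; ring)
  linarith

/-- The derivative of `f` in the constant direction `v`, as a function. -/
noncomputable def dirDeriv (v : E) (f : E → G) (x : E) : G := fderiv ℝ f x v

theorem ContDiffOn.dirDeriv {s : Set E} (hs : IsOpen s) {f : E → G} (hf : ContDiffOn ℝ ∞ f s)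
    (v : E) : ContDiffOn ℝ ∞ (dirDeriv v f) s :=
  (hf.fderiv_of_isOpen hs (by simp)).clm_apply contDiffOn_const

theorem ContDiffOn.iterate_dirDeriv {s : Set E} (hs : IsOpen s) {f : E → G}
    (hf : ContDiffOn ℝ ∞ f s) (v : E) (k : ℕ) : ContDiffOn ℝ ∞ ((_root_.dirDeriv v)^[k] f) s := by
  induction k with
  | zero => exact hf
  | succ k ih => rw [Function.iterate_succ_apply']; exact ih.dirDeriv hs v

theorem dirDeriv_comm {s : Set E} (hs : IsOpen s) {f : E → G} (hf : ContDiffOn ℝ ∞ f s)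
    (v w : E) {x : E} (hx : x ∈ s) : dirDeriv v (dirDeriv w f) x = dirDeriv w (dirDeriv v f) x := by
  have hfx : ContDiffAt ℝ ∞ f x := hf.contDiffAt (hs.mem_nhds hx)
  have hd : DifferentiableAt ℝ (fderiv ℝ f) x :=
    ((hfx.fderiv_right (m := ∞) (by simp)).differentiableAt (by simp))
  have h := hfx.isSymmSndFDerivAt
    (by simpa using (ENat.LEInfty.out : (2 : WithTop ℕ∞) ≤ ∞)) v w
  have e : ∀ v w : E, dirDeriv v (dirDeriv w f) x = fderiv ℝ (fderiv ℝ f) x v w := by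
    intro v w
    unfold dirDeriv
    rw [fderiv_clm_apply hd (differentiableAt_const w)]
    simp
  rw [e, e, h]

theorem dirDeriv_congr_of_isOpen {s : Set E} (hs : IsOpen s) {f g : E → G} (h : EqOn f g s)
    (v : E) : EqOn (dirDeriv v f) (dirDeriv v g) s := fun x hx => by
  unfold dirDeriv
  rw [(h.eventuallyEq_of_mem (hs.mem_nhds hx)).fderiv_eq]

theorem dirDeriv_iterate_comm {s : Set E} (hs : IsOpen s) {f : E → G} (hf : ContDiffOn ℝ ∞ f s)
    (v w : E) (k : ℕ) : EqOn (dirDeriv v ((dirDeriv w)^[k] f)) ((dirDeriv w)^[k] (dirDeriv v f)) s := by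
  induction k with
  | zero => exact fun x _ => rfl
  | succ k ih =>
    intro x hx
    rw [Function.iterate_succ_apply', Function.iterate_succ_apply',
      dirDeriv_comm hs (hf.iterate_dirDeriv hs w k) v w hx]
    exact dirDeriv_congr_of_isOpen hs ih w hx

theorem iteratedDeriv_slice_eq {s : Set (ℝ × E)} (hs : IsOpen s) {f : ℝ × E → G}
    (hf : ContDiffOn ℝ ∞ f s) (k : ℕ) {t : ℝ} {u : E} (h : (t, u) ∈ s) :
    iteratedDeriv k (fun r => f (r, u)) t = (dirDeriv ((1 : ℝ), (0 : E)))^[k] f (t, u) := by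
  induction k generalizing t with
  | zero => simp
  | succ k ih =>
    rw [iteratedDeriv_succ, Function.iterate_succ_apply']
    have hev : iteratedDeriv k (fun r => f (r, u)) =ᶠ[𝓝 t]
        fun r => (dirDeriv ((1 : ℝ), (0 : E)))^[k] f (r, u) := by
      have : ∀ᶠ r in 𝓝 t, (r, u) ∈ s :=
        (Continuous.prodMk_left u).continuousAt.eventually (hs.mem_nhds h)
      filter_upwards [this] with r hr using ih hr
    rw [hev.deriv_eq]
    have hd : HasFDerivAt ((dirDeriv ((1 : ℝ), (0 : E)))^[k] f) _ (t, u) :=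
      (((hf.iterate_dirDeriv hs _ k).contDiffAt (hs.mem_nhds h)).differentiableAt
        (by simp)).hasFDerivAt
    have hc : HasDerivAt (fun r : ℝ => (r, u)) ((1 : ℝ), (0 : E)) t :=
      (hasDerivAt_id t).prodMk (hasDerivAt_const t u)
    exact (hd.comp_hasDerivAt t hc).deriv

theorem fderiv_slice_eq {s : Set (ℝ × E)} (hs : IsOpen s) {f : ℝ × E → G}
    (hf : ContDiffOn ℝ ∞ f s) {t : ℝ} {u : E} (h : (t, u) ∈ s) (v : E) :
    fderiv ℝ (fun u => f (t, u)) u v = dirDeriv ((0 : ℝ), v) f (t, u) := by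
  have hd : HasFDerivAt f (fderiv ℝ f (t, u)) (t, u) :=
    ((hf.contDiffAt (hs.mem_nhds h)).differentiableAt (by simp)).hasFDerivAt
  have hc := (hasFDerivAt_const (𝕜 := ℝ) t u).prodMk (hasFDerivAt_id (𝕜 := ℝ) u)
  have := (hd.comp u hc).fderiv
  simp only [Function.comp_def] at this
  rw [this]
  simp [dirDeriv]

/-- The higher `t`-derivatives of a smooth function of `(t, u)` depend smoothly on `u`. -/
theorem contDiffAt_iteratedDeriv_slice {s : Set (ℝ × E)} (hs : IsOpen s) {f : ℝ × E → G}
    (hf : ContDiffOn ℝ ∞ f s) (k : ℕ) {t : ℝ} {u : E} (h : (t, u) ∈ s) :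
    ContDiffAt ℝ ∞ (fun u => iteratedDeriv k (fun r => f (r, u)) t) u := by
  have h1 : ContDiffAt ℝ ∞ (fun u => (dirDeriv ((1 : ℝ), (0 : E)))^[k] f (t, u)) u :=
    ((hf.iterate_dirDeriv hs _ k).contDiffAt (hs.mem_nhds h)).comp u
      (contDiffAt_const.prodMk contDiffAt_id)
  refine h1.congr_of_eventuallyEq ?_
  have : ∀ᶠ u in 𝓝 u, (t, u) ∈ s :=
    (Continuous.prodMk_right t).continuousAt.eventually (hs.mem_nhds h)
  filter_upwards [this] with u hu using iteratedDeriv_slice_eq hs hf k hu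

/-- The derivatives in `u` and the higher derivatives in `t` commute. -/
theorem fderiv_iteratedDeriv_slice {s : Set (ℝ × E)} (hs : IsOpen s) {f : ℝ × E → G}
    (hf : ContDiffOn ℝ ∞ f s) (k : ℕ) {t : ℝ} {u : E} (h : (t, u) ∈ s) (v : E) :
    fderiv ℝ (fun u => iteratedDeriv k (fun r => f (r, u)) t) u v =
      iteratedDeriv k (fun r => fderiv ℝ (fun u => f (r, u)) u v) t := by
  have h1 : (fun u => iteratedDeriv k (fun r => f (r, u)) t) =ᶠ[𝓝 u]
      fun u => (dirDeriv ((1 : ℝ), (0 : E)))^[k] f (t, u) := by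
    have : ∀ᶠ u in 𝓝 u, (t, u) ∈ s :=
      (Continuous.prodMk_right t).continuousAt.eventually (hs.mem_nhds h)
    filter_upwards [this] with u hu using iteratedDeriv_slice_eq hs hf k hu
  have h2 : (fun r => fderiv ℝ (fun u => f (r, u)) u v) =ᶠ[𝓝 t]
      fun r => dirDeriv ((0 : ℝ), v) f (r, u) := by
    have : ∀ᶠ r in 𝓝 t, (r, u) ∈ s :=
      (Continuous.prodMk_left u).continuousAt.eventually (hs.mem_nhds h)
    filter_upwards [this] with r hr using fderiv_slice_eq hs hf hr v
  rw [h1.fderiv_eq, h2.iteratedDeriv_eq k, iteratedDeriv_slice_eq hs (hf.dirDeriv hs _) k h,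
    fderiv_slice_eq hs (hf.iterate_dirDeriv hs _ k) h]
  exact dirDeriv_iterate_comm hs hf _ _ k h

end Calculus

/-! ### Homogeneous charts -/

/-- The linear action of `(ℝ, ·)` on `ι → ℝ` which multiplies the `i`-th coordinate by
`t ^ w i`. -/
def weightedScale {ι : Type*} (w : ι → ℕ) (t : ℝ) (y : ι → ℝ) : ι → ℝ := fun i => t ^ w i * y i

section WeightedScale

variable {ι : Type*} (w : ι → ℕ)

@[simp] theorem weightedScale_apply (t : ℝ) (y : ι → ℝ) (i : ι) :
    weightedScale w t y i = t ^ w i * y i := rfl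

@[simp] theorem weightedScale_one (y : ι → ℝ) : weightedScale w 1 y = y := by
  ext i; simp

theorem weightedScale_mul (t s : ℝ) (y : ι → ℝ) :
    weightedScale w (t * s) y = weightedScale w t (weightedScale w s y) := by
  ext i; simp [mul_pow, mul_assoc]

@[simp] theorem weightedScale_zero_weightedScale (t : ℝ) (y : ι → ℝ) :
    weightedScale w 0 (weightedScale w t y) = weightedScale w 0 y := by
  rw [← weightedScale_mul, zero_mul]

theorem contDiff_weightedScale [Fintype ι] :
    ContDiff ℝ ∞ (fun x : ℝ × (ι → ℝ) => weightedScale w x.1 x.2) := by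
  unfold weightedScale
  fun_prop

theorem contDiff_weightedScale_left [Fintype ι] (y : ι → ℝ) :
    ContDiff ℝ ∞ (fun t => weightedScale w t y) := by
  unfold weightedScale
  fun_prop

theorem contDiff_weightedScale_right [Fintype ι] (t : ℝ) :
    ContDiff ℝ ∞ (weightedScale w t) := by
  unfold weightedScale
  fun_prop

end WeightedScale

section HomogeneousChart

variable {m : ℕ} {M : Type u} [TopologicalSpace M] [ChartedSpace (EuclideanSpace ℝ (Fin m)) M]

/-- A chart, defined on a union of fibers of `h 0`, in which the maps `h t` are given by a diagonal
linear action with weights `w`. -/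
structure HomogeneousChart (m : ℕ) {M : Type u} [TopologicalSpace M]
    [ChartedSpace (EuclideanSpace ℝ (Fin m)) M] (h : ℝ≥0 → M → M) {ι : Type} [Fintype ι]
    (w : ι → ℕ) where
  chart : OpenPartialHomeomorph M (ι → ℝ)
  smooth : ContMDiffOn (𝓡 m) 𝓘(ℝ, ι → ℝ) ∞ chart chart.source
  smooth_symm : ContMDiffOn 𝓘(ℝ, ι → ℝ) (𝓡 m) ∞ chart.symm chart.target
  zero_mem_source : ∀ p, h 0 p ∈ chart.source ↔ p ∈ chart.source
  zero_mem_target : ∀ y, weightedScale w 0 y ∈ chart.target ↔ y ∈ chart.target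
  map_act : ∀ (t : ℝ≥0) (p : M), p ∈ chart.source → chart (h t p) = weightedScale w t (chart p)

/-- A multiplicative family of maps `h t` for which every point lies in the domain of a homogeneous
chart. The weights may depend on the point. -/
structure IsLocallyGraded (m : ℕ) {M : Type u} [TopologicalSpace M]
    [ChartedSpace (EuclideanSpace ℝ (Fin m)) M] (h : ℝ≥0 → M → M) : Prop where
  mul_act : ∀ (t s : ℝ≥0) (p : M), h (t * s) p = h t (h s p)
  exists_chart : ∀ p : M, ∃ (ι : Type) (_ : Fintype ι) (w : ι → ℕ) (Ψ : HomogeneousChart m h w),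
    p ∈ Ψ.chart.source

namespace HomogeneousChart

variable {h : ℝ≥0 → M → M} {ι : Type} [Fintype ι] {w : ι → ℕ} (Ψ : HomogeneousChart m h w)

include Ψ in
theorem act_mem_source (hmul : ∀ (t s : ℝ≥0) (p : M), h (t * s) p = h t (h s p)) (t : ℝ≥0) {p : M} :
    h t p ∈ Ψ.chart.source ↔ p ∈ Ψ.chart.source := by
  rw [← Ψ.zero_mem_source, ← hmul, zero_mul, Ψ.zero_mem_source]

theorem weightedScale_mem_target (t : ℝ) {y : ι → ℝ} :
    weightedScale w t y ∈ Ψ.chart.target ↔ y ∈ Ψ.chart.target := by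
  rw [← Ψ.zero_mem_target, weightedScale_zero_weightedScale, Ψ.zero_mem_target]

/-- The action of all real numbers on the domain of a homogeneous chart. -/
def scale (t : ℝ) (p : M) : M := Ψ.chart.symm (weightedScale w t (Ψ.chart p))

variable {Ψ}

theorem weightedScale_chart_mem (t : ℝ) {p : M} (hp : p ∈ Ψ.chart.source) :
    weightedScale w t (Ψ.chart p) ∈ Ψ.chart.target :=
  (Ψ.weightedScale_mem_target t).2 (Ψ.chart.map_source hp)

theorem scale_mem_source (t : ℝ) {p : M} (hp : p ∈ Ψ.chart.source) :
    Ψ.scale t p ∈ Ψ.chart.source := Ψ.chart.map_target (weightedScale_chart_mem t hp)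

theorem chart_scale (t : ℝ) {p : M} (hp : p ∈ Ψ.chart.source) :
    Ψ.chart (Ψ.scale t p) = weightedScale w t (Ψ.chart p) :=
  Ψ.chart.right_inv (weightedScale_chart_mem t hp)

theorem scale_coe (hmul : ∀ (t s : ℝ≥0) (p : M), h (t * s) p = h t (h s p)) (t : ℝ≥0) {p : M}
    (hp : p ∈ Ψ.chart.source) : Ψ.scale t p = h t p := by
  refine Ψ.chart.injOn (scale_mem_source _ hp) ((Ψ.act_mem_source hmul t).2 hp) ?_
  rw [chart_scale _ hp, Ψ.map_act t p hp]

theorem scale_mul (t s : ℝ) {p : M} (hp : p ∈ Ψ.chart.source) :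
    Ψ.scale (t * s) p = Ψ.scale t (Ψ.scale s p) := by
  conv_rhs => rw [scale, chart_scale s hp, ← weightedScale_mul]
  rfl

theorem scale_one {p : M} (hp : p ∈ Ψ.chart.source) : Ψ.scale 1 p = p := by
  rw [scale, weightedScale_one, Ψ.chart.left_inv hp]

theorem contMDiffOn_scale : ContMDiffOn (𝓘(ℝ, ℝ).prod (𝓡 m)) (𝓡 m) ∞
    (fun x : ℝ × M => Ψ.scale x.1 x.2) (univ ×ˢ Ψ.chart.source) := by
  have h1 : ContMDiffOn (𝓘(ℝ, ℝ).prod (𝓡 m)) 𝓘(ℝ, ℝ × (ι → ℝ)) ∞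
      (fun x : ℝ × M => (x.1, Ψ.chart x.2)) (univ ×ˢ Ψ.chart.source) := by
    refine contMDiffOn_fst.prodMk_space ?_
    exact Ψ.smooth.comp contMDiffOn_snd fun x hx => hx.2
  have h2 := (contDiff_weightedScale w).contMDiff.comp_contMDiffOn h1
  exact Ψ.smooth_symm.comp h2 fun x hx => weightedScale_chart_mem x.1 hx.2

theorem contMDiff_scale_left {p : M} (hp : p ∈ Ψ.chart.source) :
    ContMDiff 𝓘(ℝ, ℝ) (𝓡 m) ∞ (fun t : ℝ => Ψ.scale t p) := by
  rw [← contMDiffOn_univ]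
  exact contMDiffOn_scale.comp (contMDiffOn_id.prodMk contMDiffOn_const) fun t _ => ⟨mem_univ _, hp⟩

/-- A smooth curve which is an orbit of `h` on either side of `0` is a weighted homogeneous curve in
a homogeneous chart: the two half-orbits have the same jet at `0`, and this jet determines them. -/
theorem chart_neg_one_of_curve {c : ℝ → M} (hc : ContMDiff 𝓘(ℝ, ℝ) (𝓡 m) ∞ c)
    (hpos : ∀ t : ℝ≥0, c t = h t (c 1)) (hneg : ∀ t : ℝ≥0, c (-t) = h t (c (-1)))
    (hp : c 1 ∈ Ψ.chart.source) :
    c (-1) ∈ Ψ.chart.source ∧ Ψ.chart (c (-1)) = weightedScale w (-1) (Ψ.chart (c 1)) := by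
  have h0 : h 0 (c 1) = h 0 (c (-1)) := by
    have h1 := hpos 0
    have h2 := hneg 0
    simp only [NNReal.coe_zero, neg_zero] at h1 h2
    rw [← h1, h2]
  have hq : c (-1) ∈ Ψ.chart.source := by
    rw [← Ψ.zero_mem_source, ← h0, Ψ.zero_mem_source]; exact hp
  refine ⟨hq, ?_⟩
  have hc0 : c 0 ∈ Ψ.chart.source := by
    have h1 := hpos 0
    rw [NNReal.coe_zero] at h1
    rw [h1, Ψ.zero_mem_source]; exact hp
  have hs : ContDiffAt ℝ ∞ (fun t => Ψ.chart (c t)) 0 :=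
    (ContMDiffAt.comp (0 : ℝ) (Ψ.smooth.contMDiffAt (Ψ.chart.open_source.mem_nhds hc0))
      hc.contMDiffAt).contDiffAt
  ext i
  refine eq_neg_one_pow_mul_of_contDiffAt (f := fun t => Ψ.chart (c t) i)
    (contDiffAt_pi.1 hs i) ?_ ?_
  · intro t ht
    lift t to ℝ≥0 using ht
    simp only [hpos t, Ψ.map_act t _ hp, weightedScale_apply]
  · intro t ht
    lift t to ℝ≥0 using ht
    simp only [hneg t, Ψ.map_act t _ hq, weightedScale_apply]

end HomogeneousChart

/-! ### Extension of the action to all real numbers -/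

namespace IsLocallyGraded

variable {h : ℝ≥0 → M → M} (hM : IsLocallyGraded m h)

include hM

/-- A smooth curve which is an orbit of `h` on either side of `0` is determined by its value
at `1`. -/
theorem curve_ext {c c' : ℝ → M} (hc : ContMDiff 𝓘(ℝ, ℝ) (𝓡 m) ∞ c)
    (hpos : ∀ t : ℝ≥0, c t = h t (c 1)) (hneg : ∀ t : ℝ≥0, c (-t) = h t (c (-1)))
    (hc' : ContMDiff 𝓘(ℝ, ℝ) (𝓡 m) ∞ c')
    (hpos' : ∀ t : ℝ≥0, c' t = h t (c' 1)) (hneg' : ∀ t : ℝ≥0, c' (-t) = h t (c' (-1)))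
    (h1 : c 1 = c' 1) : c = c' := by
  obtain ⟨ι, _, w, Ψ, hp⟩ := hM.exists_chart (c 1)
  obtain ⟨hs, he⟩ := HomogeneousChart.chart_neg_one_of_curve hc hpos hneg hp
  obtain ⟨hs', he'⟩ := HomogeneousChart.chart_neg_one_of_curve hc' hpos' hneg' (h1 ▸ hp)
  have h2 : c (-1) = c' (-1) := Ψ.chart.injOn hs hs' (by rw [he, he', h1])
  funext t
  rcases le_total 0 t with ht | ht
  · lift t to ℝ≥0 using ht
    rw [hpos, hpos', h1]
  · obtain ⟨s, rfl⟩ : ∃ s : ℝ≥0, t = -s := 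
      ⟨(-t).toNNReal, by rw [Real.coe_toNNReal _ (by linarith), neg_neg]⟩
    rw [hneg, hneg', h2]

/-- The action of all real numbers does not depend on the homogeneous chart. -/
theorem scale_eq_scale {ι ι' : Type} [Fintype ι] [Fintype ι'] {w : ι → ℕ} {w' : ι' → ℕ}
    {Ψ : HomogeneousChart m h w} {Ψ' : HomogeneousChart m h w'} {p : M}
    (hp : p ∈ Ψ.chart.source) (hp' : p ∈ Ψ'.chart.source) (t : ℝ) : Ψ.scale t p = Ψ'.scale t p := by
  have key : ∀ {ι : Type} [Fintype ι] {w : ι → ℕ} {Ψ : HomogeneousChart m h w},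
      p ∈ Ψ.chart.source → (∀ t : ℝ≥0, Ψ.scale t p = h t (Ψ.scale 1 p)) ∧
        ∀ t : ℝ≥0, Ψ.scale (-t) p = h t (Ψ.scale (-1) p) := by
    intro ι _ w Ψ hp
    refine ⟨fun t => ?_, fun t => ?_⟩
    · rw [HomogeneousChart.scale_one hp, HomogeneousChart.scale_coe hM.mul_act t hp]
    · rw [← HomogeneousChart.scale_coe hM.mul_act t (HomogeneousChart.scale_mem_source _ hp),
        ← HomogeneousChart.scale_mul _ _ hp, mul_neg_one]
  refine congrFun (hM.curve_ext (HomogeneousChart.contMDiff_scale_left hp) (key hp).1 (key hp).2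
    (HomogeneousChart.contMDiff_scale_left hp') (key hp').1 (key hp').2 ?_) t
  rw [HomogeneousChart.scale_one hp, HomogeneousChart.scale_one hp']

/-- The action in homogeneous charts does not depend on the chart, because the orbits are determined
by `h`; so the charts give an action of `(ℝ, ·)` on the whole manifold. -/
theorem exists_real_action :
    ∃ H : ℝ → M → M, IsSmoothRealAction m H ∧ ∀ (t : ℝ≥0) (p : M), H (t : ℝ) p = h t p := by
  choose ι fι w Ψ hΨ using hM.exists_chart
  have key : ∀ {ι' : Type} [Fintype ι'] {w' : ι' → ℕ} (Ψ' : HomogeneousChart m h w') (t : ℝ) (p : M),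
      p ∈ Ψ'.chart.source → (Ψ p).scale t p = Ψ'.scale t p := fun Ψ' t p hp =>
    hM.scale_eq_scale (hΨ p) hp t
  refine ⟨fun t p => (Ψ p).scale t p, ⟨?_, ?_, ?_⟩, ?_⟩
  · rintro ⟨t₀, p₀⟩
    have hN : (univ : Set ℝ) ×ˢ (Ψ p₀).chart.source ∈ 𝓝 (t₀, p₀) :=
      prod_mem_nhds univ_mem ((Ψ p₀).chart.open_source.mem_nhds (hΨ p₀))
    refine (HomogeneousChart.contMDiffOn_scale.contMDiffAt hN).congr_of_eventuallyEq ?_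
    filter_upwards [hN] with x hx using key _ _ _ hx.2
  · exact fun p => HomogeneousChart.scale_one (hΨ p)
  · intro t s p
    rw [key (Ψ p) t _ (HomogeneousChart.scale_mem_source s (hΨ p)),
      HomogeneousChart.scale_mul t s (hΨ p)]
  · exact fun t p => HomogeneousChart.scale_coe hM.mul_act t (hΨ p)

end IsLocallyGraded

namespace IsSmoothRealAction

variable {H : ℝ → M → M} (hH : IsSmoothRealAction m H)

include hH

theorem contMDiff_orbit (p : M) : ContMDiff 𝓘(ℝ, ℝ) (𝓡 m) ∞ (fun t => H t p) :=
  hH.smooth.comp (contMDiff_id.prodMk contMDiff_const)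

theorem contMDiff_act (t : ℝ) : ContMDiff (𝓡 m) (𝓡 m) ∞ (H t) :=
  hH.smooth.comp (contMDiff_const.prodMk contMDiff_id)

theorem neg_act (t : ℝ) (p : M) : H (-t) p = H t (H (-1) p) := by
  rw [← hH.mul_act, mul_neg_one]

/-- The restriction of an action of `(ℝ, ·)` to the non-negative numbers. -/
theorem isSmoothSemigroupAction : IsSmoothSemigroupAction m (fun t : ℝ≥0 => H t) where
  smooth := ⟨1, one_pos, fun x => H x.1 x.2, hH.smooth.contMDiffOn, fun _ _ => rfl⟩
  mul_act t s p := by rw [NNReal.coe_mul, hH.mul_act]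

end IsSmoothRealAction

/-- A smooth map which intertwines two actions of `(ℝ≥0, ·)` intertwines their extensions to
`(ℝ, ·)`. -/
theorem IsSmoothRealAction.map_act_of_map_homothety {m m' : ℕ} {M M' : Type u} [TopologicalSpace M]
    [ChartedSpace (EuclideanSpace ℝ (Fin m)) M] [TopologicalSpace M']
    [ChartedSpace (EuclideanSpace ℝ (Fin m')) M'] {H : ℝ → M → M} {H' : ℝ → M' → M'}
    {h' : ℝ≥0 → M' → M'} (hM' : IsLocallyGraded m' h') (hH : IsSmoothRealAction m H)
    (hH' : IsSmoothRealAction m' H') (hh' : ∀ (t : ℝ≥0) (p : M'), H' t p = h' t p) {f : M → M'}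
    (hf : ContMDiff (𝓡 m) (𝓡 m') ∞ f) (hfh : ∀ (t : ℝ≥0) (p : M), f (H t p) = h' t (f p))
    (t : ℝ) (p : M) : f (H t p) = H' t (f p) := by
  refine congrFun (hM'.curve_ext (c := fun t => f (H t p)) (c' := fun t => H' t (f p))
    (hf.comp (hH.contMDiff_orbit p)) ?_ ?_ (hH'.contMDiff_orbit _) ?_ ?_ ?_) t
  · intro t; simp only [hfh, hH.one_act]
  · intro t; simp only [hH.neg_act t, hfh]
  · intro t; simp only [hh', hH'.one_act]
  · intro t; simp only [hH'.neg_act t, hh']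
  · simp only [hH.one_act, hH'.one_act]

/-- Uniqueness is the equivariance of the identity map. -/
theorem IsLocallyGraded.existsUnique_real_action {h : ℝ≥0 → M → M} (hM : IsLocallyGraded m h) :
    ∃! H : ℝ → M → M, IsSmoothRealAction m H ∧ ∀ (t : ℝ≥0) (p : M), H (t : ℝ) p = h t p := by
  obtain ⟨H, hH, hh⟩ := hM.exists_real_action
  refine ⟨H, ⟨hH, hh⟩, ?_⟩
  rintro H' ⟨hH', hh'⟩
  funext t p
  exact hH'.map_act_of_map_homothety hM hH hh contMDiff_id (fun t p => hh' t p) t p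

end HomogeneousChart

/-! ### Existence of homogeneous charts -/

section LinearAlgebra

/-- An orbit of a linear action of `(ℝ, ·)` which is flat at `0` vanishes. -/
theorem eq_zero_of_flat_orbit {E : Type*} [NormedAddCommGroup E] [NormedSpace ℝ E]
    {A : ℝ → E →L[ℝ] E} (hone : A 1 = ContinuousLinearMap.id ℝ E)
    (hmul : ∀ t s, A (t * s) = (A t).comp (A s)) {v : E}
    (hflat : ∀ n : ℕ, (fun t => A t v) =o[𝓝[>] 0] fun t : ℝ => t ^ n) : v = 0 := by
  have hpow : ∀ j : ℕ, ‖A (2 ^ j)‖ ≤ ‖A 2‖ ^ j := by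
    intro j
    induction j with
    | zero =>
      rw [pow_zero, hone, pow_zero]
      exact ContinuousLinearMap.norm_id_le
    | succ j ih =>
      rw [pow_succ, hmul, pow_succ]
      exact (ContinuousLinearMap.opNorm_comp_le _ _).trans (by gcongr)
  obtain ⟨n, hn⟩ := pow_unbounded_of_one_lt ‖A 2‖ (one_lt_two : (1 : ℝ) < 2)
  have hlim : Tendsto (fun j : ℕ => ((2 : ℝ)⁻¹) ^ j) atTop (𝓝[>] 0) :=
    tendsto_nhdsWithin_iff.2 ⟨tendsto_pow_atTop_nhds_zero_of_lt_one (by norm_num) (by norm_num),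
      Eventually.of_forall fun j => by simp only [mem_Ioi]; positivity⟩
  have h1 : (fun _ : ℕ => v) =o[atTop] fun _ : ℕ => (1 : ℝ) := by
    rw [isLittleO_iff]
    intro C hC
    filter_upwards [hlim.eventually (isLittleO_iff.1 (hflat n) hC)] with j hj
    -- `A (2 ^ j)` undoes the contraction `A (2⁻¹ ^ j)`, and its norm grows at most like `2 ^ (n j)`
    have e : v = A (2 ^ j) (A ((2 : ℝ)⁻¹ ^ j) v) := by
      rw [← ContinuousLinearMap.comp_apply, ← hmul, ← mul_pow, mul_inv_cancel₀ two_ne_zero, one_pow,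
        hone, ContinuousLinearMap.id_apply]
    calc ‖v‖ = ‖A (2 ^ j) (A ((2 : ℝ)⁻¹ ^ j) v)‖ := by rw [← e]
      _ ≤ ‖A (2 ^ j)‖ * ‖A ((2 : ℝ)⁻¹ ^ j) v‖ := ContinuousLinearMap.le_opNorm _ _
      _ ≤ (2 ^ n) ^ j * (C * ‖((2 : ℝ)⁻¹ ^ j) ^ n‖) := by
          gcongr
          exact (hpow j).trans (by gcongr)
      _ = C * ‖(1 : ℝ)‖ := by
          rw [Real.norm_of_nonneg (by positivity), norm_one, ← pow_mul, ← pow_mul, mul_comm n j,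
            mul_left_comm, ← mul_pow, mul_inv_cancel₀ two_ne_zero, one_pow]
  rw [isLittleO_one_iff] at h1
  exact tendsto_nhds_unique tendsto_const_nhds h1

/-- Out of a family of vector-valued linear maps without common kernel one can choose components
which form linear coordinates. -/
theorem exists_coordinates_of_iInf_ker_eq_bot {m : ℕ}
    (D : ℕ → EuclideanSpace ℝ (Fin m) →L[ℝ] EuclideanSpace ℝ (Fin m))
    (hD : ∀ v, (∀ k, D k v = 0) → v = 0) :
    ∃ (κ : Type) (_ : Fintype κ) (k : κ → ℕ) (i : κ → Fin m)
      (L : EuclideanSpace ℝ (Fin m) ≃L[ℝ] (κ → ℝ)), ∀ v a, L v a = D (k a) v (i a) := by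
  let F : ℕ × Fin m → Module.Dual ℝ (EuclideanSpace ℝ (Fin m)) := fun x =>
    ((EuclideanSpace.proj x.2 : EuclideanSpace ℝ (Fin m) →L[ℝ] ℝ).comp (D x.1)).toLinearMap
  have hF : ∀ x v, F x v = D x.1 v x.2 := fun x v => rfl
  obtain ⟨κ, a, -, hspan, hli⟩ := exists_linearIndependent' ℝ F
  have hfin : Finite κ := hli.finite
  have := Fintype.ofFinite κ
  have htop : Submodule.span ℝ (range F) = ⊤ := by
    rw [← Subspace.dualCoannihilator_dualAnnihilator_eq (W := Submodule.span ℝ (range F))]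
    have : (Submodule.span ℝ (range F)).dualCoannihilator = ⊥ := by
      rw [eq_bot_iff]
      intro v hv
      rw [Submodule.mem_dualCoannihilator] at hv
      refine (Submodule.mem_bot ℝ).2 (hD v fun k => ?_)
      ext i
      exact hv _ (Submodule.subset_span ⟨(k, i), rfl⟩)
    rw [this, Submodule.dualAnnihilator_bot]
  let T : EuclideanSpace ℝ (Fin m) →ₗ[ℝ] (κ → ℝ) := LinearMap.pi fun x => F (a x)
  have hT : Function.Injective T := by
    rw [← LinearMap.ker_eq_bot, eq_bot_iff]
    intro v hv
    have hv' : ∀ x, F (a x) v = 0 := fun x => congrFun (LinearMap.mem_ker.1 hv) x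
    have hall : ∀ l ∈ Submodule.span ℝ (range (F ∘ a)), l v = 0 := by
      intro l hl
      induction hl using Submodule.span_induction with
      | mem l hl => obtain ⟨x, rfl⟩ := hl; exact hv' x
      | zero => rfl
      | add l l' _ _ h h' => simp [h, h']
      | smul c l _ h => simp [h]
    refine (Submodule.mem_bot ℝ).2 (hD v fun k => ?_)
    ext i
    exact hall (F (k, i)) (by rw [hspan, htop]; trivial)
  have hdim : Module.finrank ℝ (EuclideanSpace ℝ (Fin m)) = Module.finrank ℝ (κ → ℝ) := by
    rw [Module.finrank_fintype_fun_eq_card, ← finrank_span_eq_card hli, hspan, htop, finrank_top,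
      Subspace.dual_finrank_eq]
  refine ⟨κ, this, fun x => (a x).1, fun x => (a x).2,
    (LinearMap.linearEquivOfInjective T hT hdim).toContinuousLinearEquiv, fun v x => ?_⟩
  rfl

end LinearAlgebra

section Existence

variable {m : ℕ} {M : Type u} [TopologicalSpace M] [ChartedSpace (EuclideanSpace ℝ (Fin m)) M]

/-- An action read in the chart at `q` is smooth where it is defined. -/
theorem contDiffOn_action_in_charts [IsManifold (𝓡 m) ∞ M] {g : ℝ → M → M}
    (hg : IsSmoothRealAction m g) (q : M) :
    IsOpen {x : ℝ × EuclideanSpace ℝ (Fin m) | x.2 ∈ (chartAt (EuclideanSpace ℝ (Fin m)) q).target ∧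
      g x.1 ((chartAt (EuclideanSpace ℝ (Fin m)) q).symm x.2) ∈
        (chartAt (EuclideanSpace ℝ (Fin m)) q).source} ∧
    ContDiffOn ℝ ∞ (fun x : ℝ × EuclideanSpace ℝ (Fin m) =>
        chartAt (EuclideanSpace ℝ (Fin m)) q
          (g x.1 ((chartAt (EuclideanSpace ℝ (Fin m)) q).symm x.2)))
      {x | x.2 ∈ (chartAt (EuclideanSpace ℝ (Fin m)) q).target ∧
        g x.1 ((chartAt (EuclideanSpace ℝ (Fin m)) q).symm x.2) ∈
          (chartAt (EuclideanSpace ℝ (Fin m)) q).source} := by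
  set φ := chartAt (EuclideanSpace ℝ (Fin m)) q with hφ
  have h1 : ContMDiffOn (𝓘(ℝ, ℝ × EuclideanSpace ℝ (Fin m))) (𝓡 m) ∞
      (fun x : ℝ × EuclideanSpace ℝ (Fin m) => g x.1 (φ.symm x.2)) (Prod.snd ⁻¹' φ.target) := by
    have h2 : ContMDiffOn (𝓘(ℝ, ℝ × EuclideanSpace ℝ (Fin m))) (𝓡 m) ∞
        (fun x : ℝ × EuclideanSpace ℝ (Fin m) => φ.symm x.2) (Prod.snd ⁻¹' φ.target) :=
      (contMDiffOn_chart_symm (I := 𝓡 m) (x := q)).comp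
        (contDiff_snd.contMDiff.contMDiffOn) fun x hx => hx
    exact hg.smooth.comp_contMDiffOn
      ((contDiff_fst (𝕜 := ℝ) (n := ∞)).contMDiff.contMDiffOn.prodMk h2)
  have hopen : IsOpen (Prod.snd ⁻¹' φ.target : Set (ℝ × EuclideanSpace ℝ (Fin m))) :=
    φ.open_target.preimage continuous_snd
  refine ⟨h1.continuousOn.isOpen_inter_preimage hopen φ.open_source, ?_⟩
  rw [← contMDiffOn_iff_contDiffOn]
  exact (contMDiffOn_chart (I := 𝓡 m) (x := q)).comp (h1.mono fun x hx => hx.1) fun x hx => hx.2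

/-- Homogeneous functions with independent differentials at a point fixed by the action: components
of the Taylor coefficients at `t = 0` of the orbits `t ↦ g t p`, read in a chart. -/
theorem exists_homogeneous_functions [IsManifold (𝓡 m) ∞ M] {g : ℝ → M → M}
    (hg : IsSmoothRealAction m g) {q : M} (hq : g 0 q = q) :
    ∃ (κ : Type) (_ : Fintype κ) (w : κ → ℕ) (Y : M → κ → ℝ)
      (L : EuclideanSpace ℝ (Fin m) ≃L[ℝ] (κ → ℝ)) (N : Set (EuclideanSpace ℝ (Fin m))),
      (∀ t p, Y (g t p) = weightedScale w t (Y p)) ∧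
      IsOpen N ∧ chartAt (EuclideanSpace ℝ (Fin m)) q q ∈ N ∧
      ContDiffOn ℝ ∞ (fun u => Y ((chartAt (EuclideanSpace ℝ (Fin m)) q).symm u)) N ∧
      HasFDerivAt (fun u => Y ((chartAt (EuclideanSpace ℝ (Fin m)) q).symm u))
        (L : EuclideanSpace ℝ (Fin m) →L[ℝ] (κ → ℝ))
        (chartAt (EuclideanSpace ℝ (Fin m)) q q) := by
  obtain ⟨hΩ, hf⟩ := contDiffOn_action_in_charts hg q
  set φ := chartAt (EuclideanSpace ℝ (Fin m)) q with hφ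
  set f : ℝ × EuclideanSpace ℝ (Fin m) → EuclideanSpace ℝ (Fin m) :=
    fun x => φ (g x.1 (φ.symm x.2)) with hfdef
  set Ω := {x : ℝ × EuclideanSpace ℝ (Fin m) | x.2 ∈ φ.target ∧ g x.1 (φ.symm x.2) ∈ φ.source}
    with hΩdef
  set u₀ := φ q with hu₀
  have hqs : q ∈ φ.source := mem_chart_source _ q
  have hgq : ∀ t, g t q = q := fun t => by
    conv_lhs => rw [← hq, ← hg.mul_act, mul_zero]
    exact hq
  have hmem : ∀ t, (t, u₀) ∈ Ω := fun t => by
    refine ⟨φ.map_source hqs, ?_⟩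
    simp only [hu₀, φ.left_inv hqs, hgq, hqs]
  have hfq : ∀ t, f (t, u₀) = u₀ := fun t => by
    simp only [hfdef, hu₀, φ.left_inv hqs, hgq]
  -- the linear action on the tangent space at `q`, read in the chart
  let A : ℝ → EuclideanSpace ℝ (Fin m) →L[ℝ] EuclideanSpace ℝ (Fin m) := fun t =>
    fderiv ℝ (fun u => f (t, u)) u₀
  have hslice : ∀ t, ContDiffAt ℝ ∞ (fun u => f (t, u)) u₀ := fun t =>
    (hf.contDiffAt (hΩ.mem_nhds (hmem t))).comp u₀ (contDiffAt_const.prodMk contDiffAt_id)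
  have hA : ∀ t, HasFDerivAt (fun u => f (t, u)) (A t) u₀ := fun t =>
    ((hslice t).differentiableAt (by simp)).hasFDerivAt
  have hnear : ∀ t, ∀ᶠ u in 𝓝 u₀, (t, u) ∈ Ω := fun t =>
    (Continuous.prodMk_right t).continuousAt.eventually (hΩ.mem_nhds (hmem t))
  have hone : A 1 = ContinuousLinearMap.id ℝ _ := by
    refine (hA 1).unique ((hasFDerivAt_id u₀).congr_of_eventuallyEq ?_)
    filter_upwards [hnear 1] with u hu
    simp only [hfdef, hg.one_act, id, φ.right_inv hu.1]
  have hmul : ∀ t s, A (t * s) = (A t).comp (A s) := by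
    intro t s
    have h1 : HasFDerivAt (fun u => f (t, u)) (A t) (f (s, u₀)) := by rw [hfq]; exact hA t
    refine (hA (t * s)).unique ((h1.comp u₀ (hA s)).congr_of_eventuallyEq ?_)
    filter_upwards [hnear s] with u hu
    simp only [hfdef, Function.comp_apply, φ.left_inv hu.2, hg.mul_act]
  -- the Taylor coefficients (up to factorials) of the orbits; if a vector is killed by all their
  -- differentials, then its orbit under `A` is flat
  let X : ℕ → EuclideanSpace ℝ (Fin m) → EuclideanSpace ℝ (Fin m) := fun k u =>
    iteratedDeriv k (fun t => f (t, u)) 0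
  have hcomm : ∀ k v, fderiv ℝ (X k) u₀ v = iteratedDeriv k (fun t => A t v) 0 := fun k v =>
    fderiv_iteratedDeriv_slice hΩ hf k (hmem 0) v
  have hX : ∀ k, ∀ u, (0, u) ∈ Ω → ContDiffAt ℝ ∞ (X k) u := fun k u hu =>
    contDiffAt_iteratedDeriv_slice hΩ hf k hu
  obtain ⟨κ, _, k, i, L, hL⟩ := exists_coordinates_of_iInf_ker_eq_bot (fun k => fderiv ℝ (X k) u₀)
    (by
      intro v hv
      refine eq_zero_of_flat_orbit hone hmul (v := v) fun n => ?_
      have hsm : ContDiffAt ℝ ∞ (fun t => A t v) 0 := by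
        have h1 : (fun t => A t v) = fun t => dirDeriv ((0 : ℝ), v) f (t, u₀) :=
          funext fun t => fderiv_slice_eq hΩ hf (hmem t) v
        rw [h1]
        exact ((hf.dirDeriv hΩ _).contDiffAt (hΩ.mem_nhds (hmem 0))).comp (0 : ℝ)
          (contDiffAt_id.prodMk contDiffAt_const)
      have h0 : A 0 v = 0 := by
        have := hcomm 0 v
        rw [hv 0] at this
        simpa using this.symm
      have h2 := (iteratedDeriv_eq_zero_iff_isLittleO hsm n).1 fun i _ _ => by
        rw [← hcomm, hv]
      simpa [h0] using h2)
  let Y : M → κ → ℝ := fun p a => iteratedDeriv (k a) (fun t => φ (g t p)) 0 (i a)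
  have hYX : ∀ a u, Y (φ.symm u) a = X (k a) u (i a) := fun a u => rfl
  refine ⟨κ, inferInstance, k, Y, L, {u | (0, u) ∈ Ω}, ?_,
    hΩ.preimage (Continuous.prodMk_right 0), hmem 0, ?_, ?_⟩
  · intro t p
    ext a
    have h1 : (fun s => φ (g s (g t p))) = fun s => (fun r => φ (g r p)) (t * s) := by
      funext s; simp only [← hg.mul_act, mul_comm]
    simp only [Y, weightedScale_apply]
    rw [h1, iteratedDeriv_comp_mul_left (fun r => φ (g r p)) t (k a)]
    simp
  · rw [contDiffOn_pi]
    intro a u hu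
    exact ((EuclideanSpace.proj (i a) : EuclideanSpace ℝ (Fin m) →L[ℝ] ℝ).contDiff.contDiffAt.comp u
      (hX (k a) u hu)).contDiffWithinAt
  · rw [hasFDerivAt_pi']
    intro a
    have h1 : HasFDerivAt (X (k a)) (fderiv ℝ (X (k a)) u₀) u₀ :=
      ((hX (k a) u₀ (hmem 0)).differentiableAt (by simp)).hasFDerivAt
    refine HasFDerivAt.congr_fderiv
      ((EuclideanSpace.proj (i a) : EuclideanSpace ℝ (Fin m) →L[ℝ] ℝ).hasFDerivAt.comp u₀ h1) ?_
    ext v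
    exact (hL v a).symm

/-- The inverse function theorem, with an inverse which is smooth on its whole domain. -/
theorem exists_smooth_local_inverse {E F : Type*} [NormedAddCommGroup E] [NormedSpace ℝ E]
    [CompleteSpace E] [NormedAddCommGroup F] [NormedSpace ℝ F] {f : E → F} {N : Set E}
    (hN : IsOpen N) (hf : ContDiffOn ℝ ∞ f N) {u₀ : E} (hu₀ : u₀ ∈ N) {L : E ≃L[ℝ] F}
    (hL : HasFDerivAt f (L : E →L[ℝ] F) u₀) :
    ∃ Θ : OpenPartialHomeomorph E F, u₀ ∈ Θ.source ∧ Θ.source ⊆ N ∧ (∀ u, Θ u = f u) ∧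
      ContDiffOn ℝ ∞ Θ.symm Θ.target := by
  have hat : ContDiffAt ℝ ∞ f u₀ := hf.contDiffAt (hN.mem_nhds hu₀)
  have hne : (∞ : WithTop ℕ∞) ≠ 0 := by simp
  set Θ₀ := hat.toOpenPartialHomeomorph f hL hne with hΘ₀
  have hcoe : ∀ u, Θ₀ u = f u := fun u => by
    rw [hΘ₀, ContDiffAt.toOpenPartialHomeomorph_coe]
  have hd : ContinuousOn (fderiv ℝ f) N := hf.continuousOn_fderiv_of_isOpen hN (by simp)
  have hN' : IsOpen (N ∩ fderiv ℝ f ⁻¹' range ContinuousLinearEquiv.toContinuousLinearMap) :=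
    hd.isOpen_inter_preimage hN ContinuousLinearEquiv.isOpen
  refine ⟨Θ₀.restrOpen _ hN', ⟨hat.mem_toOpenPartialHomeomorph_source hL hne, hu₀, L, ?_⟩, ?_, hcoe,
    ?_⟩
  · rw [hL.fderiv]
  · exact fun u hu => hu.2.1
  · intro y hy
    have hys := (Θ₀.restrOpen _ hN').map_target hy
    obtain ⟨-, hyN, L', hL'⟩ := hys
    refine ContDiffAt.contDiffWithinAt ?_
    refine OpenPartialHomeomorph.contDiffAt_symm (Θ₀.restrOpen _ hN') (f₀' := L') hy ?_ ?_
    · have h1 : HasFDerivAt f (fderiv ℝ f ((Θ₀.restrOpen _ hN').symm y))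
          ((Θ₀.restrOpen _ hN').symm y) :=
        ((hf.contDiffAt (hN.mem_nhds hyN)).differentiableAt (by simp)).hasFDerivAt
      rw [← hL'] at h1
      exact h1.congr_of_eventuallyEq (Eventually.of_forall hcoe)
    · exact (hf.contDiffAt (hN.mem_nhds hyN)).congr_of_eventuallyEq (Eventually.of_forall hcoe)

/-- Homogeneous functions which are coordinates near a fixed point `q` are coordinates on a union of
orbits: a contraction `g s` with `s` small moves any point of the fiber over `q` into the domain of
the local coordinates. -/
theorem exists_saturated_chart {g : ℝ → M → M} (hg : IsSmoothRealAction m g) {κ : Type} [Fintype κ]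
    {w : κ → ℕ} {Y : M → κ → ℝ} (hY : ∀ t p, Y (g t p) = weightedScale w t (Y p))
    (Θ : OpenPartialHomeomorph M (κ → ℝ)) (hΘY : ∀ p ∈ Θ.source, Θ p = Y p)
    (hΘ : ContMDiffOn (𝓡 m) 𝓘(ℝ, κ → ℝ) ∞ Θ Θ.source)
    (hΘ' : ContMDiffOn 𝓘(ℝ, κ → ℝ) (𝓡 m) ∞ Θ.symm Θ.target)
    {q : M} (hq : g 0 q ∈ Θ.source) :
    ∃ Ψ : OpenPartialHomeomorph M (κ → ℝ), q ∈ Ψ.source ∧ (∀ p, Ψ p = Y p) ∧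
      ContMDiffOn (𝓡 m) 𝓘(ℝ, κ → ℝ) ∞ Ψ Ψ.source ∧
      ContMDiffOn 𝓘(ℝ, κ → ℝ) (𝓡 m) ∞ Ψ.symm Ψ.target ∧
      (∀ p, g 0 p ∈ Ψ.source ↔ p ∈ Ψ.source) ∧
      (∀ y, weightedScale w 0 y ∈ Ψ.target ↔ y ∈ Ψ.target) := by
  have hcont : ∀ t, Continuous (g t) := fun t => (hg.contMDiff_act t).continuous
  set S : Set M := g 0 ⁻¹' Θ.source with hS
  have hSo : IsOpen S := Θ.open_source.preimage (hcont 0)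
  have hinv : ∀ {s : ℝ} (_ : s ≠ 0) (p : M), g s⁻¹ (g s p) = p := fun {s} hs p => by
    rw [← hg.mul_act, inv_mul_cancel₀ hs, hg.one_act]
  have hinv' : ∀ {s : ℝ} (_ : s ≠ 0) (y : κ → ℝ), weightedScale w s⁻¹ (weightedScale w s y) = y :=
    fun {s} hs y => by rw [← weightedScale_mul, inv_mul_cancel₀ hs, weightedScale_one]
  have hactS : ∀ t p, g t p ∈ S ↔ p ∈ S := fun t p => by
    simp only [hS, mem_preimage, ← hg.mul_act, zero_mul]
  have hsmall : ∀ p ∈ S, ∀ᶠ s in 𝓝[≠] (0 : ℝ), g s p ∈ Θ.source := fun p hp =>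
    ((hg.contMDiff_orbit p).continuous.continuousAt.eventually
      (Θ.open_source.mem_nhds hp)).filter_mono nhdsWithin_le_nhds
  have hne : ∀ᶠ s in 𝓝[≠] (0 : ℝ), s ≠ 0 := self_mem_nhdsWithin
  have hinj : InjOn Y S := by
    intro p hp p' hp' he
    obtain ⟨s, h1, h2, hs⟩ := ((hsmall p hp).and ((hsmall p' hp').and hne)).exists
    have h3 : g s p = g s p' := Θ.injOn h1 h2 (by rw [hΘY _ h1, hΘY _ h2, hY, hY, he])
    rw [← hinv hs p, h3, hinv hs]
  -- smooth local inverses of `Y`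
  have hloc : ∀ p ∈ S, ∃ G : (κ → ℝ) → M, ContMDiffAt 𝓘(ℝ, κ → ℝ) (𝓡 m) ∞ G (Y p) ∧
      ∀ᶠ y in 𝓝 (Y p), G y ∈ S ∧ Y (G y) = y := by
    intro p hp
    obtain ⟨s, h1, hs⟩ := ((hsmall p hp).and hne).exists
    have ht : weightedScale w s (Y p) ∈ Θ.target := by
      rw [← hY, ← hΘY _ h1]; exact Θ.map_source h1
    have hG : ContMDiffAt 𝓘(ℝ, κ → ℝ) (𝓡 m) ∞
        (fun y => g s⁻¹ (Θ.symm (weightedScale w s y))) (Y p) :=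
      (hg.contMDiff_act s⁻¹).contMDiffAt.comp (Y p)
        ((hΘ'.contMDiffAt (Θ.open_target.mem_nhds ht)).comp (Y p)
          (contDiff_weightedScale_right w s).contMDiff.contMDiffAt)
    have hGp : g s⁻¹ (Θ.symm (weightedScale w s (Y p))) = p := by
      rw [← hY, ← hΘY _ h1, Θ.left_inv h1, hinv hs]
    refine ⟨_, hG, ?_⟩
    have e1 := hG.continuousAt.eventually (hSo.mem_nhds (by simp only [hGp]; exact hp))
    have e2 := (contDiff_weightedScale_right w s).continuous.continuousAt.eventually
      (Θ.open_target.mem_nhds ht)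
    filter_upwards [e1, e2] with y hy1 hy2
    refine ⟨hy1, ?_⟩
    rw [hY, ← hΘY _ (Θ.map_target hy2), Θ.right_inv hy2, hinv' hs]
  have : Nonempty M := ⟨q⟩
  have hinvS : ∀ p ∈ S, Function.invFunOn Y S (Y p) = p := fun p hp =>
    hinj.leftInvOn_invFunOn hp
  have hsymm : ∀ p ∈ S, ContMDiffAt 𝓘(ℝ, κ → ℝ) (𝓡 m) ∞ (Function.invFunOn Y S) (Y p) := by
    intro p hp
    obtain ⟨G, hG, hev⟩ := hloc p hp
    refine hG.congr_of_eventuallyEq ?_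
    filter_upwards [hev] with y hy
    conv_lhs => rw [← hy.2]
    exact hinvS _ hy.1
  -- near `p` the function `Y` is the homogeneous extension of `Θ`
  have hsm : ∀ p ∈ S, ContMDiffAt (𝓡 m) 𝓘(ℝ, κ → ℝ) ∞ Y p := by
    intro p hp
    obtain ⟨s, h1, hs⟩ := ((hsmall p hp).and hne).exists
    have h2 : ContMDiffAt (𝓡 m) 𝓘(ℝ, κ → ℝ) ∞
        (fun p => weightedScale w s⁻¹ (Θ (g s p))) p :=
      (contDiff_weightedScale_right w s⁻¹).contMDiff.contMDiffAt.comp p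
        ((hΘ.contMDiffAt (Θ.open_source.mem_nhds h1)).comp p (hg.contMDiff_act s).contMDiffAt)
    refine h2.congr_of_eventuallyEq ?_
    filter_upwards [(hcont s).continuousAt.eventually (Θ.open_source.mem_nhds h1)] with p' hp'
    rw [hΘY _ hp', hY, hinv' hs]
  have hTo : IsOpen (Y '' S) := by
    rw [isOpen_iff_mem_nhds]
    rintro _ ⟨p, hp, rfl⟩
    obtain ⟨G, -, hev⟩ := hloc p hp
    filter_upwards [hev] with y hy using ⟨G y, hy.1, hy.2⟩
  -- the inverse on `Y '' S` agrees near each point with one of the smooth local inverses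
  let Ψ : OpenPartialHomeomorph M (κ → ℝ) :=
    { toFun := Y
      invFun := Function.invFunOn Y S
      source := S
      target := Y '' S
      map_source' := fun p hp => mem_image_of_mem Y hp
      map_target' := by rintro _ ⟨p, hp, rfl⟩; rw [hinvS p hp]; exact hp
      left_inv' := hinvS
      right_inv' := by rintro _ ⟨p, hp, rfl⟩; rw [hinvS p hp]
      open_source := hSo
      open_target := hTo
      continuousOn_toFun := fun p hp => (hsm p hp).continuousAt.continuousWithinAt
      continuousOn_invFun := by
        rintro _ ⟨p, hp, rfl⟩; exact (hsymm p hp).continuousAt.continuousWithinAt }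
  refine ⟨Ψ, hq, fun _ => rfl, fun p hp => (hsm p hp).contMDiffWithinAt, ?_,
    fun p => hactS 0 p, fun y => ⟨?_, ?_⟩⟩
  · rintro _ ⟨p, hp, rfl⟩
    exact (hsymm p hp).contMDiffWithinAt
  · -- if `δ₀ y` is a value of `Y`, then `δₛ y` is one for small `s`, and hence so is `y`
    rintro ⟨p₀, hp₀, he₀⟩
    have hpΘ : g 0 p₀ ∈ Θ.source := hp₀
    have he : Θ (g 0 p₀) = weightedScale w 0 y := by
      rw [hΘY _ hpΘ, hY, he₀, weightedScale_zero_weightedScale]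
    have ht : weightedScale w 0 y ∈ Θ.target := he ▸ Θ.map_source hpΘ
    have hc : ContinuousAt (fun s => weightedScale w s y) 0 :=
      (contDiff_weightedScale_left w y).continuous.continuousAt
    have e1 : ∀ᶠ s in 𝓝 (0 : ℝ), weightedScale w s y ∈ Θ.target :=
      hc.eventually (Θ.open_target.mem_nhds ht)
    have e2 : ∀ᶠ s in 𝓝 (0 : ℝ), Θ.symm (weightedScale w s y) ∈ S := by
      have : ContinuousAt (fun s => Θ.symm (weightedScale w s y)) 0 :=
        ContinuousAt.comp (Θ.continuousAt_symm ht) hc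
      refine this.eventually (hSo.mem_nhds ?_)
      simp only [← he, Θ.left_inv hpΘ, hactS]
      exact hp₀
    obtain ⟨s, ⟨h1, h2⟩, hs⟩ := (((e1.and e2).filter_mono nhdsWithin_le_nhds).and hne).exists
    refine ⟨g s⁻¹ (Θ.symm (weightedScale w s y)), (hactS _ _).2 h2, ?_⟩
    rw [hY, ← hΘY _ (Θ.map_target h1), Θ.right_inv h1, hinv' hs]
  · rintro ⟨p, hp, rfl⟩
    exact ⟨g 0 p, (hactS 0 p).2 hp, hY 0 p⟩

/-- A smooth action of `(ℝ≥0, ·)`, precomposed with `t ↦ t ^ 2`, is a smooth action of `(ℝ, ·)`. -/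
theorem IsSmoothSemigroupAction.isSmoothRealAction_sq {h : ℝ≥0 → M → M}
    (hh : IsSmoothSemigroupAction m h) (hone : ∀ p, h 1 p = p) :
    IsSmoothRealAction m (fun t : ℝ => h (t ^ 2).toNNReal) where
  smooth := by
    obtain ⟨ε, hε, H, hH, he⟩ := hh.smooth
    have h1 : ContMDiff (𝓘(ℝ, ℝ).prod (𝓡 m)) (𝓘(ℝ, ℝ).prod (𝓡 m)) ∞
        (fun x : ℝ × M => (x.1 ^ 2, x.2)) :=
      ((contDiff_id.pow 2).contMDiff.comp contMDiff_fst).prodMk contMDiff_snd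
    have h2 : ContMDiff (𝓘(ℝ, ℝ).prod (𝓡 m)) (𝓡 m) ∞ (fun x : ℝ × M => H (x.1 ^ 2, x.2)) :=
      hH.comp_contMDiff h1 fun x => ⟨lt_of_lt_of_le (neg_lt_zero.2 hε) (sq_nonneg _), mem_univ _⟩
    convert h2 using 2 with x
    rw [← he, Real.coe_toNNReal _ (sq_nonneg _)]
  one_act p := by simpa using hone p
  mul_act t s p := by
    rw [mul_pow, Real.toNNReal_mul (sq_nonneg _), hh.mul_act]

/-- A smooth action of `(ℝ≥0, ·)` admits homogeneous charts. They are constructed for the action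
`h (t ^ 2)` of `(ℝ, ·)`, which has the same orbits and twice the weights. -/
theorem IsSmoothSemigroupAction.isLocallyGraded [IsManifold (𝓡 m) ∞ M] {h : ℝ≥0 → M → M}
    (hh : IsSmoothSemigroupAction m h) (hone : ∀ p, h 1 p = p) : IsLocallyGraded m h := by
  refine ⟨hh.mul_act, fun p => ?_⟩
  have hg := hh.isSmoothRealAction_sq hone
  set g : ℝ → M → M := fun t => h (t ^ 2).toNNReal with hgdef
  have hg0 : ∀ p, g 0 p = h 0 p := fun p => by simp [hgdef]
  have hq : g 0 (g 0 p) = g 0 p := by rw [← hg.mul_act, zero_mul]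
  obtain ⟨κ, _, w, Y, L, N, hY, hN, hqN, hYN, hL⟩ := exists_homogeneous_functions hg hq
  set φ := chartAt (EuclideanSpace ℝ (Fin m)) (g 0 p) with hφ
  -- `g (-1)` is the identity, so that homogeneous functions of odd degree vanish
  have heven : ∀ a, Even (w a) := by
    intro a
    by_contra hodd
    rw [Nat.not_even_iff_odd] at hodd
    have hzero : ∀ p, Y p a = 0 := by
      intro p
      have h1 : g (-1) p = p := by simp [hgdef, hone]
      have h2 := congrFun (hY (-1) p) a
      rw [h1, weightedScale_apply, hodd.neg_one_pow] at h2
      linarith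
    have h1 := (hasFDerivAt_pi'.1 hL a).unique
      ((hasFDerivAt_const (0 : ℝ) (φ (g 0 p))).congr_of_eventuallyEq
        (Eventually.of_forall fun u => hzero _))
    have h2 := congrArg (fun T => T (L.symm fun _ => 1)) h1
    simp at h2
  obtain ⟨Θ₀, hΘ₀, hΘ₀N, hΘ₀Y, hΘ₀s⟩ := exists_smooth_local_inverse hN hYN hqN hL
  set Θ := φ.trans Θ₀ with hΘ
  have hΘY : ∀ p ∈ Θ.source, Θ p = Y p := by
    intro p hp
    rw [hΘ, OpenPartialHomeomorph.trans_source] at hp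
    rw [hΘ, OpenPartialHomeomorph.coe_trans, Function.comp_apply, hΘ₀Y, φ.left_inv hp.1]
  have hΘ₀c : ContDiffOn ℝ ∞ Θ₀ Θ₀.source :=
    (hYN.mono hΘ₀N).congr fun u _ => hΘ₀Y u
  have hsm : ContMDiffOn (𝓡 m) 𝓘(ℝ, κ → ℝ) ∞ Θ Θ.source := by
    rw [hΘ, OpenPartialHomeomorph.trans_source, OpenPartialHomeomorph.coe_trans]
    exact hΘ₀c.contMDiffOn.comp ((contMDiffOn_chart (I := 𝓡 m)).mono inter_subset_left)
      fun p hp => hp.2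
  have hsm' : ContMDiffOn 𝓘(ℝ, κ → ℝ) (𝓡 m) ∞ Θ.symm Θ.target := by
    rw [hΘ, OpenPartialHomeomorph.trans_target, OpenPartialHomeomorph.coe_trans_symm]
    exact (contMDiffOn_chart_symm (I := 𝓡 m)).comp (hΘ₀s.contMDiffOn.mono inter_subset_left)
      fun p hp => hp.2
  obtain ⟨Ψ, hpΨ, hΨY, hΨ, hΨ', hΨ0, hΨ0'⟩ := exists_saturated_chart hg hY Θ hΘY hsm hsm' (q := p)
    (by
      rw [hΘ, OpenPartialHomeomorph.trans_source]
      exact ⟨mem_chart_source _ _, hΘ₀⟩)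
  have hscale : ∀ t : ℝ≥0, ∀ y, weightedScale w (Real.sqrt t) y =
      weightedScale (fun a => w a / 2) t y := by
    intro t y
    ext a
    obtain ⟨j, hj⟩ := heven a
    simp only [weightedScale_apply]
    rw [show w a = 2 * (w a / 2) by omega, pow_mul, Real.sq_sqrt t.coe_nonneg]
    simp
  have hact : ∀ (t : ℝ≥0) p, g (Real.sqrt t) p = h t p := by
    intro t p
    simp only [hgdef]
    rw [Real.sq_sqrt t.coe_nonneg, Real.toNNReal_coe]
  refine ⟨κ, inferInstance, fun a => w a / 2, ⟨Ψ, hΨ, hΨ', ?_, ?_, ?_⟩, hpΨ⟩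
  · intro p
    rw [← hg0, hΨ0]
  · intro y
    have := hscale 0 y
    rw [NNReal.coe_zero, Real.sqrt_zero] at this
    rw [← this, hΨ0']
  · intro t p _
    rw [← hact, hΨY, hΨY, hY, hscale]

end Existence

/-! ### The weights of homogeneous charts -/

section Weights

variable {m : ℕ} {M : Type u} [TopologicalSpace M] [ChartedSpace (EuclideanSpace ℝ (Fin m)) M]

/-- The multiset of the values of a family of weights. -/
def weightMultiset {ι : Type*} [Fintype ι] (w : ι → ℕ) : Multiset ℕ := Finset.univ.val.map w

/-- Two families of weights whose diagonal actions are linearly conjugate agree up to order, as the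
weights can be read off from the eigenvalues `2 ^ w i`. -/
theorem weightMultiset_eq_of_conj {ι ι' : Type} [Fintype ι] [Fintype ι'] {w : ι → ℕ} {w' : ι' → ℕ}
    (L : (ι → ℝ) ≃ₗ[ℝ] (ι' → ℝ))
    (hL : ∀ y, L (weightedScale w 2 y) = weightedScale w' 2 (L y)) :
    weightMultiset w = weightMultiset w' := by
  classical
  have key : ∀ {ι : Type} [Fintype ι] [DecidableEq ι] (w : ι → ℕ),
      (Matrix.toLin' (Matrix.diagonal fun i => (2 : ℝ) ^ w i)).charpoly.roots =
        (weightMultiset w).map fun k => (2 : ℝ) ^ k := by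
    intro ι _ _ w
    have h1 : ∏ i, (Polynomial.X - Polynomial.C ((2 : ℝ) ^ w i)) =
        (((weightMultiset w).map fun k => (2 : ℝ) ^ k).map
          fun a => Polynomial.X - Polynomial.C a).prod := by
      rw [weightMultiset, Multiset.map_map, Multiset.map_map]
      rfl
    rw [Matrix.charpoly_toLin', Matrix.charpoly_diagonal, h1,
      Polynomial.roots_multiset_prod_X_sub_C]
  have hdiag : ∀ {ι : Type} [Fintype ι] [DecidableEq ι] (w : ι → ℕ) (y : ι → ℝ),
      Matrix.toLin' (Matrix.diagonal fun i => (2 : ℝ) ^ w i) y = weightedScale w 2 y := by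
    intro ι _ _ w y
    ext i
    simp [Matrix.mulVec_diagonal]
  have hconj : L.conj (Matrix.toLin' (Matrix.diagonal fun i => (2 : ℝ) ^ w i)) =
      Matrix.toLin' (Matrix.diagonal fun i => (2 : ℝ) ^ w' i) := by
    refine LinearMap.ext fun y => ?_
    rw [LinearEquiv.conj_apply_apply, hdiag, hdiag, hL, L.apply_symm_apply]
  have h := LinearEquiv.charpoly_conj L (Matrix.toLin' (Matrix.diagonal fun i => (2 : ℝ) ^ w i))
  rw [hconj] at h
  have h2 := (key w).symm.trans ((congrArg Polynomial.roots h.symm).trans (key w'))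
  exact Multiset.map_injective (pow_right_injective₀ two_pos (by norm_num)) h2

theorem HomogeneousChart.weightMultiset_eq {h : ℝ≥0 → M → M}
    (hmul : ∀ (t s : ℝ≥0) (p : M), h (t * s) p = h t (h s p))
    {ι ι' : Type} [Fintype ι] [Fintype ι'] {w : ι → ℕ} {w' : ι' → ℕ}
    (Ψ : HomogeneousChart m h w) (Ψ' : HomogeneousChart m h w') {p : M}
    (hp : p ∈ Ψ.chart.source) (hp' : p ∈ Ψ'.chart.source) :
    weightMultiset w = weightMultiset w' := by
  -- the differential at a fixed point of the transition map conjugates the two diagonal actions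
  set q := h 0 p with hqdef
  have hq : q ∈ Ψ.chart.source := (Ψ.zero_mem_source p).2 hp
  have hq' : q ∈ Ψ'.chart.source := (Ψ'.zero_mem_source p).2 hp'
  have hfix : ∀ t, h t q = q := fun t => by rw [hqdef, ← hmul, mul_zero]
  have hsm : ∀ {ι ι' : Type} [Fintype ι] [Fintype ι'] {w : ι → ℕ} {w' : ι' → ℕ}
      (Ψ : HomogeneousChart m h w) (Ψ' : HomogeneousChart m h w'), q ∈ Ψ.chart.source →
      q ∈ Ψ'.chart.source → HasFDerivAt (fun y => Ψ'.chart (Ψ.chart.symm y))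
        (fderiv ℝ (fun y => Ψ'.chart (Ψ.chart.symm y)) (Ψ.chart q)) (Ψ.chart q) := by
    intro ι ι' _ _ w w' Ψ Ψ' hq hq'
    have h1 : ContMDiffAt 𝓘(ℝ, ι → ℝ) 𝓘(ℝ, ι' → ℝ) ∞ (fun y => Ψ'.chart (Ψ.chart.symm y))
        (Ψ.chart q) :=
      ContMDiffAt.comp (I' := 𝓡 m) (Ψ.chart q)
        (Ψ'.smooth.contMDiffAt (Ψ'.chart.open_source.mem_nhds
          (by rw [Ψ.chart.left_inv hq]; exact hq')))
        (Ψ.smooth_symm.contMDiffAt (Ψ.chart.open_target.mem_nhds (Ψ.chart.map_source hq)))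
    exact (h1.contDiffAt.differentiableAt (by simp)).hasFDerivAt
  have hev : ∀ {ι ι' : Type} [Fintype ι] [Fintype ι'] {w : ι → ℕ} {w' : ι' → ℕ}
      (Ψ : HomogeneousChart m h w) (Ψ' : HomogeneousChart m h w'), q ∈ Ψ.chart.source →
      q ∈ Ψ'.chart.source → ∀ᶠ y in 𝓝 (Ψ.chart q), y ∈ Ψ.chart.target ∧
        Ψ.chart.symm y ∈ Ψ'.chart.source := by
    intro ι ι' _ _ w w' Ψ Ψ' hq hq'
    have ht := Ψ.chart.map_source hq
    exact (Ψ.chart.open_target.eventually_mem ht).and ((Ψ.chart.continuousAt_symm ht).eventually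
      (Ψ'.chart.open_source.mem_nhds (by rw [Ψ.chart.left_inv hq]; exact hq')))
  have hinv : ∀ {ι ι' : Type} [Fintype ι] [Fintype ι'] {w : ι → ℕ} {w' : ι' → ℕ}
      (Ψ : HomogeneousChart m h w) (Ψ' : HomogeneousChart m h w'), q ∈ Ψ.chart.source →
      q ∈ Ψ'.chart.source → (fderiv ℝ (fun y => Ψ.chart (Ψ'.chart.symm y)) (Ψ'.chart q)).comp
        (fderiv ℝ (fun y => Ψ'.chart (Ψ.chart.symm y)) (Ψ.chart q)) =
        ContinuousLinearMap.id ℝ _ := by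
    intro ι ι' _ _ w w' Ψ Ψ' hq hq'
    have h1 := hsm Ψ' Ψ hq' hq
    have h3 : HasFDerivAt (fun y => Ψ.chart (Ψ'.chart.symm y))
        (fderiv ℝ (fun y => Ψ.chart (Ψ'.chart.symm y)) (Ψ'.chart q))
        (Ψ'.chart (Ψ.chart.symm (Ψ.chart q))) := by rw [Ψ.chart.left_inv hq]; exact h1
    refine (h3.comp (Ψ.chart q) (hsm Ψ Ψ' hq hq')).unique
      ((hasFDerivAt_id _).congr_of_eventuallyEq ?_)
    filter_upwards [hev Ψ Ψ' hq hq'] with y hy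
    simp only [Function.comp_apply, Ψ'.chart.left_inv hy.2, Ψ.chart.right_inv hy.1, id]
  let L : (ι → ℝ) ≃ₗ[ℝ] (ι' → ℝ) := LinearEquiv.ofLinearMap
    (fderiv ℝ (fun y => Ψ'.chart (Ψ.chart.symm y)) (Ψ.chart q)).toLinearMap
    (fderiv ℝ (fun y => Ψ.chart (Ψ'.chart.symm y)) (Ψ'.chart q)).toLinearMap
    (by
      have := congrArg ContinuousLinearMap.toLinearMap (hinv Ψ' Ψ hq' hq)
      exact this)
    (by
      have := congrArg ContinuousLinearMap.toLinearMap (hinv Ψ Ψ' hq hq')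
      exact this)
  let δ : ∀ {ι : Type} [Fintype ι] (_ : ι → ℕ), (ι → ℝ) →L[ℝ] (ι → ℝ) := fun {ι} _ w =>
    ContinuousLinearMap.pi fun i => ((2 : ℝ) ^ w i) • ContinuousLinearMap.proj i
  have hδ : ∀ {ι : Type} [Fintype ι] (w : ι → ℕ) (x : ι → ℝ),
      HasFDerivAt (weightedScale w 2) (δ w) x := fun {ι} _ w x => (δ w).hasFDerivAt
  have hfixΨ : ∀ {ι : Type} [Fintype ι] {w : ι → ℕ} (Ψ : HomogeneousChart m h w),
      q ∈ Ψ.chart.source → weightedScale w 2 (Ψ.chart q) = Ψ.chart q := by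
    intro ι _ w Ψ hq
    have := Ψ.map_act 2 q hq
    rw [hfix] at this
    exact this.symm
  refine weightMultiset_eq_of_conj L fun y => ?_
  have h1 : HasFDerivAt (fun y => Ψ'.chart (Ψ.chart.symm y))
      (fderiv ℝ (fun y => Ψ'.chart (Ψ.chart.symm y)) (Ψ.chart q))
      (weightedScale w 2 (Ψ.chart q)) := by rw [hfixΨ Ψ hq]; exact hsm Ψ Ψ' hq hq'
  have h2 := (h1.comp (Ψ.chart q) (hδ w _)).unique
    (((hδ w' _).comp (Ψ.chart q) (hsm Ψ Ψ' hq hq')).congr_of_eventuallyEq (by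
      filter_upwards [hev Ψ Ψ' hq hq'] with y hy
      simp only [Function.comp_apply]
      have e := Ψ'.map_act 2 _ hy.2
      have e1 : h 2 (Ψ.chart.symm y) ∈ Ψ.chart.source :=
        (Ψ.act_mem_source hmul 2).2 (Ψ.chart.map_target hy.1)
      have e2 := Ψ.map_act 2 _ (Ψ.chart.map_target hy.1)
      rw [Ψ.chart.right_inv hy.1] at e2
      have e3 : Ψ.chart.symm (weightedScale w 2 y) = h 2 (Ψ.chart.symm y) := by
        rw [← Ψ.chart.left_inv e1, e2]; rfl
      rw [e3, e]; rfl))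
  exact congrArg (fun T => T y) h2

/-- On a connected manifold the weights of all homogeneous charts agree. -/
theorem IsLocallyGraded.exists_weightMultiset [ConnectedSpace M] {h : ℝ≥0 → M → M}
    (hM : IsLocallyGraded m h) :
    ∃ S : Multiset ℕ, ∀ (ι : Type) [Fintype ι] (w : ι → ℕ) (Ψ : HomogeneousChart m h w) (p : M),
      p ∈ Ψ.chart.source → weightMultiset w = S := by
  choose ι fι w Ψ hΨ using hM.exists_chart
  have hloc : IsLocallyConstant fun p => weightMultiset (w p) := by
    rw [IsLocallyConstant.iff_eventually_eq]
    intro p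
    filter_upwards [(Ψ p).chart.open_source.mem_nhds (hΨ p)] with p' hp'
    exact HomogeneousChart.weightMultiset_eq hM.mul_act (Ψ p') (Ψ p) (hΨ p') hp'
  obtain ⟨p₀⟩ := (inferInstance : Nonempty M)
  refine ⟨weightMultiset (w p₀), fun ι' _ w' Ψ' p hp => ?_⟩
  rw [HomogeneousChart.weightMultiset_eq hM.mul_act Ψ' (Ψ p) hp (hΨ p)]
  exact hloc.apply_eq_of_preconnectedSpace p p₀

/-- The same homogeneous chart with its coordinates renamed. -/
noncomputable def HomogeneousChart.reindex {h : ℝ≥0 → M → M} {ι ι' : Type} [Fintype ι] [Fintype ι']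
    {w : ι → ℕ} (Ψ : HomogeneousChart m h w) (σ : ι' ≃ ι) : HomogeneousChart m h (w ∘ σ) where
  chart := Ψ.chart.transHomeomorph
    (LinearEquiv.funCongrLeft ℝ ℝ σ).toContinuousLinearEquiv.toHomeomorph
  smooth := (LinearEquiv.funCongrLeft ℝ ℝ σ).toContinuousLinearEquiv.contDiff.contMDiff.comp_contMDiffOn
    Ψ.smooth
  smooth_symm := Ψ.smooth_symm.comp
    (LinearEquiv.funCongrLeft ℝ ℝ σ).toContinuousLinearEquiv.symm.contDiff.contMDiff.contMDiffOn
    fun _ hy => hy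
  zero_mem_source := Ψ.zero_mem_source
  zero_mem_target y := by
    refine Iff.trans ?_ (Ψ.zero_mem_target _)
    rw [OpenPartialHomeomorph.transHomeomorph_target, mem_preimage]
    refine Iff.of_eq (congrArg (· ∈ Ψ.chart.target) ?_)
    ext i
    show (0 : ℝ) ^ w (σ (σ.symm i)) * y (σ.symm i) = 0 ^ w i * y (σ.symm i)
    rw [σ.apply_symm_apply]
  map_act t p hp := by
    ext i
    exact congrFun (Ψ.map_act t p hp) (σ i)

/-- The weights of the coordinates of `ℝ ^ d₀ × ℝ ^ d`: the first factor has weight zero, and an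
index `r : Fin n` stands for the weight `r + 1`. -/
def stdWeight (d₀ : ℕ) {n : ℕ} (d : Fin n → ℕ) : Fin d₀ ⊕ (Σ r : Fin n, Fin (d r)) → ℕ :=
  Sum.elim (fun _ => 0) fun x => x.1 + 1

theorem exists_equiv_of_card_fiber_eq {α β : Type} [Fintype α] [Fintype β] {f : α → ℕ} {g : β → ℕ}
    (h : ∀ k, Fintype.card {a // f a = k} = Fintype.card {b // g b = k}) :
    ∃ σ : α ≃ β, g ∘ σ = f := by
  let e : ∀ k, {a // f a = k} ≃ {b // g b = k} := fun k => Fintype.equivOfCardEq (h k)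
  refine ⟨(Equiv.sigmaFiberEquiv f).symm.trans
    ((Equiv.sigmaCongrRight e).trans (Equiv.sigmaFiberEquiv g)), funext fun a => ?_⟩
  exact (e (f a) ⟨a, rfl⟩).2

/-- Weights bounded by `n` are, up to the order of the coordinates, those of `ℝ ^ d₀ × ℝ ^ d`, where
the dimensions `d₀` and `d r` are the multiplicities of the weights `0` and `r + 1`. -/
theorem exists_equiv_stdWeight {ι : Type} [Fintype ι] {w : ι → ℕ} {S : Multiset ℕ}
    (hS : weightMultiset w = S) {n : ℕ} (hw : ∀ i, w i ≤ n) :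
    ∃ σ : (Fin (S.count 0) ⊕ (Σ r : Fin n, Fin (S.count ((r : ℕ) + 1)))) ≃ ι,
      w ∘ σ = stdWeight _ fun r : Fin n => S.count ((r : ℕ) + 1) := by
  subst hS
  classical
  have hcount : ∀ k, (weightMultiset w).count k = Fintype.card {i // w i = k} := by
    intro k
    rw [weightMultiset, Multiset.count_map, Fintype.card_subtype]
    simp only [eq_comm]
    rfl
  refine exists_equiv_of_card_fiber_eq fun k => ?_
  rw [← hcount k, Fintype.card_subtype, Finset.card_filter, Fintype.sum_sum_type,
    Fintype.sum_sigma]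
  rcases k with _ | k
  · simp [stdWeight]
  · by_cases hk : k < n
    · have : ∀ r : Fin n, ((r : ℕ) = k) ↔ r = ⟨k, hk⟩ := fun r => by rw [Fin.ext_iff]
      simp [stdWeight, this]
    · have h0 : (weightMultiset w).count (k + 1) = 0 := by
        refine Multiset.count_eq_zero_of_notMem fun hmem => ?_
        obtain ⟨i, -, hi⟩ := Multiset.mem_map.1 hmem
        have := hw i
        omega
      have : ∀ r : Fin n, ¬ (r : ℕ) = k := fun r => by omega
      simp [stdWeight, this, h0]

end Weights

/-! ### The graded bundle of an atlas of homogeneous charts -/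

section Coordinates

variable {d₀ n : ℕ} {d : Fin n → ℕ}

/-- The coordinates of degree zero. -/
def baseCoords (y : Fin d₀ ⊕ (Σ r : Fin n, Fin (d r)) → ℝ) : EuclideanSpace ℝ (Fin d₀) :=
  WithLp.toLp 2 fun i => y (Sum.inl i)

/-- The coordinates of positive degree. -/
def fiberCoords (y : Fin d₀ ⊕ (Σ r : Fin n, Fin (d r)) → ℝ) : StdGradedSpace d :=
  WithLp.toLp 2 fun i => y (Sum.inr i)

/-- The point with given coordinates of degree zero and of positive degree. -/
def joinCoords (a : EuclideanSpace ℝ (Fin d₀)) (v : StdGradedSpace d) :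
    Fin d₀ ⊕ (Σ r : Fin n, Fin (d r)) → ℝ := Sum.elim a v

@[simp] theorem baseCoords_joinCoords (a : EuclideanSpace ℝ (Fin d₀)) (v : StdGradedSpace d) :
    baseCoords (joinCoords a v) = a := rfl

@[simp] theorem fiberCoords_joinCoords (a : EuclideanSpace ℝ (Fin d₀)) (v : StdGradedSpace d) :
    fiberCoords (joinCoords a v) = v := rfl

@[simp] theorem joinCoords_baseCoords_fiberCoords (y : Fin d₀ ⊕ (Σ r : Fin n, Fin (d r)) → ℝ) :
    joinCoords (baseCoords y) (fiberCoords y) = y := by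
  ext i; rcases i with i | i <;> rfl

theorem weightedScale_joinCoords (t : ℝ≥0) (a : EuclideanSpace ℝ (Fin d₀)) (v : StdGradedSpace d) :
    weightedScale (stdWeight d₀ d) t (joinCoords a v) = joinCoords a (stdHomothety d t v) := by
  ext i; rcases i with i | i <;> simp [weightedScale, stdWeight, joinCoords, stdHomothety]

theorem weightedScale_zero_eq_joinCoords (y : Fin d₀ ⊕ (Σ r : Fin n, Fin (d r)) → ℝ) :
    weightedScale (stdWeight d₀ d) 0 y = joinCoords (baseCoords y) 0 := by
  ext i; rcases i with i | i <;> simp [weightedScale, stdWeight, joinCoords, baseCoords]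

theorem baseCoords_weightedScale (t : ℝ) (y : Fin d₀ ⊕ (Σ r : Fin n, Fin (d r)) → ℝ) :
    baseCoords (weightedScale (stdWeight d₀ d) t y) = baseCoords y := by
  ext i; simp [baseCoords, weightedScale, stdWeight]

theorem fiberCoords_weightedScale (t : ℝ≥0) (y : Fin d₀ ⊕ (Σ r : Fin n, Fin (d r)) → ℝ) :
    fiberCoords (weightedScale (stdWeight d₀ d) t y) = stdHomothety d t (fiberCoords y) := by
  ext i; simp [fiberCoords, weightedScale, stdWeight, stdHomothety]

theorem contDiff_baseCoords : ContDiff ℝ ∞ (baseCoords (d₀ := d₀) (d := d)) :=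
  contDiff_euclidean.2 fun i => contDiff_apply ℝ ℝ (Sum.inl i)

theorem contDiff_fiberCoords : ContDiff ℝ ∞ (fiberCoords (d₀ := d₀) (d := d)) :=
  contDiff_euclidean.2 fun i => contDiff_apply ℝ ℝ (Sum.inr i)

theorem contDiff_joinCoords : ContDiff ℝ ∞
    (fun x : EuclideanSpace ℝ (Fin d₀) × StdGradedSpace d => joinCoords x.1 x.2) := by
  rw [contDiff_pi]
  rintro (i | i)
  · exact (EuclideanSpace.proj i : EuclideanSpace ℝ (Fin d₀) →L[ℝ] ℝ).contDiff.comp contDiff_fst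
  · exact (EuclideanSpace.proj i : StdGradedSpace d →L[ℝ] ℝ).contDiff.comp contDiff_snd

end Coordinates

section GradedAtlas

variable {m : ℕ} {M : Type u} [TopologicalSpace M] [ChartedSpace (EuclideanSpace ℝ (Fin m)) M]

/-- The maps `h t` are multiplicative, and homogeneous charts with one and the same family of
weights in `{0, …, n}`, in standard order, cover the manifold. -/
structure HasGradedAtlas (m : ℕ) {M : Type u} [TopologicalSpace M]
    [ChartedSpace (EuclideanSpace ℝ (Fin m)) M] (h : ℝ≥0 → M → M) (d₀ : ℕ) {n : ℕ}
    (d : Fin n → ℕ) : Prop where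
  mul_act : ∀ (t s : ℝ≥0) (p : M), h (t * s) p = h t (h s p)
  exists_chart : ∀ p : M, ∃ Ψ : HomogeneousChart m h (stdWeight d₀ d), p ∈ Ψ.chart.source

namespace HasGradedAtlas

variable {h : ℝ≥0 → M → M} {d₀ n : ℕ} {d : Fin n → ℕ}

/-- The base of the graded bundle: the set of fixed points `h 0 (M)`. -/
def Base (_ : HasGradedAtlas m h d₀ d) : Type u := ↥(range (h 0))

variable (C : HasGradedAtlas m h d₀ d)

include C in
theorem isLocallyGraded : IsLocallyGraded m h where
  mul_act := C.mul_act
  exists_chart p := by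
    obtain ⟨Ψ, hΨ⟩ := C.exists_chart p
    exact ⟨_, inferInstance, _, Ψ, hΨ⟩

include C in
theorem contMDiff_act (t : ℝ≥0) : ContMDiff (𝓡 m) (𝓡 m) ∞ (h t) := by
  obtain ⟨H, hH, hh⟩ := C.isLocallyGraded.exists_real_action
  exact (hH.contMDiff_act t).congr fun p => (hh t p).symm

instance : TopologicalSpace C.Base := inferInstanceAs (TopologicalSpace ↥(range (h 0)))

instance [T2Space M] : T2Space C.Base := inferInstanceAs (T2Space ↥(range (h 0)))

instance [SecondCountableTopology M] : SecondCountableTopology C.Base :=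
  inferInstanceAs (SecondCountableTopology ↥(range (h 0)))

/-- The inclusion of the base. -/
def incl (b : C.Base) : M := b.1

/-- The projection onto the base. -/
def proj (p : M) : C.Base := ⟨h 0 p, p, rfl⟩

theorem incl_proj (p : M) : C.incl (C.proj p) = h 0 p := rfl

theorem act_incl (t : ℝ≥0) (b : C.Base) : h t (C.incl b) = C.incl b := by
  obtain ⟨_, p, rfl⟩ := b
  show h t (h 0 p) = h 0 p
  rw [← C.mul_act, mul_zero]

theorem proj_eq_iff {p : M} {b : C.Base} : C.proj p = b ↔ h 0 p = C.incl b := Subtype.ext_iff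

theorem continuous_incl : Continuous C.incl := continuous_subtype_val

theorem continuous_proj : Continuous C.proj :=
  (C.contMDiff_act 0).continuous.subtype_mk _

section Chart

variable {C} (Ψ : HomogeneousChart m h (stdWeight d₀ d))

/-- The point over `b` with given fiber coordinates. -/
def fiberPoint (C : HasGradedAtlas m h d₀ d) (b : C.Base) (v : StdGradedSpace d) : M :=
  Ψ.chart.symm (joinCoords (baseCoords (Ψ.chart (C.incl b))) v)

theorem joinCoords_mem_target_iff (a : EuclideanSpace ℝ (Fin d₀)) (v : StdGradedSpace d) :
    joinCoords a v ∈ Ψ.chart.target ↔ joinCoords a (0 : StdGradedSpace d) ∈ Ψ.chart.target := by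
  rw [← Ψ.zero_mem_target, weightedScale_zero_eq_joinCoords, baseCoords_joinCoords]

variable {Ψ}

theorem chart_incl {b : C.Base} (hb : C.incl b ∈ Ψ.chart.source) :
    Ψ.chart (C.incl b) = joinCoords (baseCoords (Ψ.chart (C.incl b))) 0 := by
  have h1 := Ψ.map_act 0 _ hb
  rwa [C.act_incl, NNReal.coe_zero, weightedScale_zero_eq_joinCoords] at h1

theorem joinCoords_chart_mem {b : C.Base} (hb : C.incl b ∈ Ψ.chart.source) (v : StdGradedSpace d) :
    joinCoords (baseCoords (Ψ.chart (C.incl b))) v ∈ Ψ.chart.target := by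
  rw [joinCoords_mem_target_iff, ← chart_incl hb]
  exact Ψ.chart.map_source hb

theorem fiberPoint_mem_source {b : C.Base} (hb : C.incl b ∈ Ψ.chart.source) (v : StdGradedSpace d) :
    fiberPoint Ψ C b v ∈ Ψ.chart.source := Ψ.chart.map_target (joinCoords_chart_mem hb v)

theorem chart_fiberPoint {b : C.Base} (hb : C.incl b ∈ Ψ.chart.source) (v : StdGradedSpace d) :
    Ψ.chart (fiberPoint Ψ C b v) = joinCoords (baseCoords (Ψ.chart (C.incl b))) v :=
  Ψ.chart.right_inv (joinCoords_chart_mem hb v)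

theorem incl_proj_mem_source {p : M} : C.incl (C.proj p) ∈ Ψ.chart.source ↔ p ∈ Ψ.chart.source :=
  Ψ.zero_mem_source p

theorem proj_fiberPoint {b : C.Base} (hb : C.incl b ∈ Ψ.chart.source) (v : StdGradedSpace d) :
    C.proj (fiberPoint Ψ C b v) = b := by
  rw [proj_eq_iff]
  refine Ψ.chart.injOn ((Ψ.zero_mem_source _).2 (fiberPoint_mem_source hb v)) hb ?_
  rw [Ψ.map_act 0 _ (fiberPoint_mem_source hb v), chart_fiberPoint hb, NNReal.coe_zero,
    weightedScale_zero_eq_joinCoords, baseCoords_joinCoords, ← chart_incl hb]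

theorem baseCoords_chart_proj {p : M} (hp : p ∈ Ψ.chart.source) :
    baseCoords (Ψ.chart (C.incl (C.proj p))) = baseCoords (Ψ.chart p) := by
  rw [incl_proj, Ψ.map_act 0 p hp, baseCoords_weightedScale]

theorem fiberPoint_proj {p : M} (hp : p ∈ Ψ.chart.source) :
    fiberPoint Ψ C (C.proj p) (fiberCoords (Ψ.chart p)) = p := by
  rw [fiberPoint, baseCoords_chart_proj hp, joinCoords_baseCoords_fiberCoords, Ψ.chart.left_inv hp]

theorem fiberPoint_stdHomothety {b : C.Base} (hb : C.incl b ∈ Ψ.chart.source) (t : ℝ≥0)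
    (v : StdGradedSpace d) : fiberPoint Ψ C b (stdHomothety d t v) = h t (fiberPoint Ψ C b v) := by
  refine Ψ.chart.injOn (fiberPoint_mem_source hb _)
    ((Ψ.act_mem_source C.mul_act t).2 (fiberPoint_mem_source hb v)) ?_
  rw [chart_fiberPoint hb, Ψ.map_act t _ (fiberPoint_mem_source hb v), chart_fiberPoint hb,
    weightedScale_joinCoords]

variable (C Ψ)

/-- The chart of the base given by the degree zero coordinates of a homogeneous chart. -/
def baseChart : OpenPartialHomeomorph C.Base (EuclideanSpace ℝ (Fin d₀)) where
  toFun b := baseCoords (Ψ.chart (C.incl b))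
  invFun a := C.proj (Ψ.chart.symm (joinCoords a 0))
  source := C.incl ⁻¹' Ψ.chart.source
  target := {a | joinCoords a (0 : StdGradedSpace d) ∈ Ψ.chart.target}
  map_source' b hb := joinCoords_chart_mem hb 0
  map_target' a ha := incl_proj_mem_source.2 (Ψ.chart.map_target ha)
  left_inv' b hb := proj_fiberPoint hb 0
  right_inv' a ha := by
    rw [baseCoords_chart_proj (Ψ.chart.map_target ha), Ψ.chart.right_inv ha, baseCoords_joinCoords]
  open_source := Ψ.chart.open_source.preimage C.continuous_incl
  open_target := Ψ.chart.open_target.preimage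
    (contDiff_joinCoords.continuous.comp (Continuous.prodMk_left 0))
  continuousOn_toFun := contDiff_baseCoords.continuous.comp_continuousOn
    (Ψ.chart.continuousOn.comp C.continuous_incl.continuousOn fun _ hb => hb)
  continuousOn_invFun := C.continuous_proj.comp_continuousOn
    (Ψ.chart.continuousOn_symm.comp
      (contDiff_joinCoords.continuous.comp (Continuous.prodMk_left 0)).continuousOn fun _ ha => ha)

end Chart

noncomputable instance : ChartedSpace (EuclideanSpace ℝ (Fin d₀)) C.Base where
  atlas := range C.baseChart
  chartAt b := C.baseChart (C.exists_chart (C.incl b)).choose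
  mem_chart_source b := (C.exists_chart (C.incl b)).choose_spec
  chart_mem_atlas _ := mem_range_self _

instance : IsManifold (𝓡 d₀) ∞ C.Base := by
  refine isManifold_of_contDiffOn _ _ _ ?_
  rintro _ _ ⟨Ψ, rfl⟩ ⟨Ψ', rfl⟩
  rw [← contMDiffOn_iff_contDiffOn]
  have hjoin : ContDiff ℝ ∞ (fun a : EuclideanSpace ℝ (Fin d₀) =>
      joinCoords a (0 : StdGradedSpace d)) :=
    contDiff_joinCoords.comp (contDiff_id.prodMk contDiff_const)
  have h1 : ContMDiffOn 𝓘(ℝ, EuclideanSpace ℝ (Fin d₀)) 𝓘(ℝ, EuclideanSpace ℝ (Fin d₀)) ∞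
      (fun a => baseCoords (Ψ'.chart (h 0 (Ψ.chart.symm (joinCoords a 0)))))
      ((C.baseChart Ψ).symm.trans (C.baseChart Ψ')).source := by
    refine contDiff_baseCoords.contMDiff.comp_contMDiffOn (Ψ'.smooth.comp
      ((C.contMDiff_act 0).comp_contMDiffOn
        (Ψ.smooth_symm.comp hjoin.contMDiff.contMDiffOn ?_)) ?_)
    · exact fun a ha => ha.1
    · exact fun a ha => ha.2
  refine h1.mono ?_
  intro a ha
  exact ha.1

theorem contMDiffOn_baseChart (Ψ : HomogeneousChart m h (stdWeight d₀ d)) :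
    ContMDiffOn (𝓡 d₀) (𝓡 d₀) ∞ (C.baseChart Ψ) (C.baseChart Ψ).source :=
  contMDiffOn_of_mem_maximalAtlas (IsManifold.subset_maximalAtlas (mem_range_self Ψ))

theorem contMDiff_proj : ContMDiff (𝓡 m) (𝓡 d₀) ∞ C.proj := by
  intro p
  rw [contMDiffAt_iff_target]
  refine ⟨C.continuous_proj.continuousAt, ?_⟩
  set Ψ := (C.exists_chart (C.incl (C.proj p))).choose with hΨ
  have hp : h 0 p ∈ Ψ.chart.source := (C.exists_chart (C.incl (C.proj p))).choose_spec
  have h1 : ContMDiffAt (𝓡 m) 𝓘(ℝ, EuclideanSpace ℝ (Fin d₀)) ∞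
      (fun p => baseCoords (Ψ.chart (h 0 p))) p :=
    contDiff_baseCoords.contMDiff.contMDiffAt.comp p
      ((Ψ.smooth.contMDiffAt (Ψ.chart.open_source.mem_nhds hp)).comp p
        (C.contMDiff_act 0).contMDiffAt)
  exact h1

/-- The local trivialization given by the positive degree coordinates of a homogeneous chart. -/
def trivialization (Ψ : HomogeneousChart m h (stdWeight d₀ d)) :
    Bundle.Trivialization (StdGradedSpace d) C.proj where
  toFun p := (C.proj p, fiberCoords (Ψ.chart p))
  invFun x := fiberPoint Ψ C x.1 x.2
  source := Ψ.chart.source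
  target := (C.incl ⁻¹' Ψ.chart.source) ×ˢ univ
  map_source' p hp := ⟨incl_proj_mem_source.2 hp, mem_univ _⟩
  map_target' x hx := fiberPoint_mem_source hx.1 x.2
  left_inv' p hp := fiberPoint_proj hp
  right_inv' x hx := by
    rw [proj_fiberPoint hx.1, chart_fiberPoint hx.1, fiberCoords_joinCoords]
  open_source := Ψ.chart.open_source
  open_target := (Ψ.chart.open_source.preimage C.continuous_incl).prod isOpen_univ
  continuousOn_toFun := C.continuous_proj.continuousOn.prodMk
    (contDiff_fiberCoords.continuous.comp_continuousOn Ψ.chart.continuousOn)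
  continuousOn_invFun := by
    refine Ψ.chart.continuousOn_symm.comp (contDiff_joinCoords.continuous.comp_continuousOn
      (ContinuousOn.prodMk ?_ continuousOn_snd)) fun x hx => joinCoords_chart_mem hx.1 x.2
    exact (C.baseChart Ψ).continuousOn.comp continuousOn_fst fun x hx => hx.1
  baseSet := C.incl ⁻¹' Ψ.chart.source
  open_baseSet := Ψ.chart.open_source.preimage C.continuous_incl
  source_eq := by
    ext p
    exact incl_proj_mem_source.symm
  target_eq := rfl
  proj_toFun p _ := rfl

theorem contMDiffOn_trivialization (Ψ : HomogeneousChart m h (stdWeight d₀ d)) :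
    ContMDiffOn (𝓡 m) ((𝓡 d₀).prod 𝓘(ℝ, StdGradedSpace d)) ∞ (C.trivialization Ψ)
      (C.trivialization Ψ).source :=
  C.contMDiff_proj.contMDiffOn.prodMk (contDiff_fiberCoords.contMDiff.comp_contMDiffOn Ψ.smooth)

theorem contMDiffOn_trivialization_symm (Ψ : HomogeneousChart m h (stdWeight d₀ d)) :
    ContMDiffOn ((𝓡 d₀).prod 𝓘(ℝ, StdGradedSpace d)) (𝓡 m) ∞
      (C.trivialization Ψ).toOpenPartialHomeomorph.symm (C.trivialization Ψ).target := by
  have h1 : ContMDiffOn ((𝓡 d₀).prod 𝓘(ℝ, StdGradedSpace d)) (𝓡 d₀) ∞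
      (fun x : C.Base × StdGradedSpace d => C.baseChart Ψ x.1)
      ((C.incl ⁻¹' Ψ.chart.source) ×ˢ univ) :=
    (C.contMDiffOn_baseChart Ψ).comp contMDiffOn_fst fun x hx => hx.1
  have h2 := contDiff_joinCoords.contMDiff.comp_contMDiffOn (h1.prodMk_space contMDiffOn_snd)
  exact Ψ.smooth_symm.comp h2 fun x hx => joinCoords_chart_mem hx.1 x.2

theorem fiberPoint_mem_source' {Ψ Ψ' : HomogeneousChart m h (stdWeight d₀ d)} {b : C.Base}
    (hb : C.incl b ∈ Ψ.chart.source) (hb' : C.incl b ∈ Ψ'.chart.source) (v : StdGradedSpace d) :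
    fiberPoint Ψ C b v ∈ Ψ'.chart.source := by
  rw [← incl_proj_mem_source (C := C), proj_fiberPoint hb]
  exact hb'

theorem fiberCoords_fiberPoint_leftInv {Ψ Ψ' : HomogeneousChart m h (stdWeight d₀ d)} {b : C.Base}
    (hb : C.incl b ∈ Ψ.chart.source) (hb' : C.incl b ∈ Ψ'.chart.source) (v : StdGradedSpace d) :
    fiberCoords (Ψ.chart (fiberPoint Ψ' C b (fiberCoords (Ψ'.chart (fiberPoint Ψ C b v))))) = v := by
  have h1 := fiberPoint_proj (C := C) (C.fiberPoint_mem_source' hb hb' v)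
  rw [proj_fiberPoint hb] at h1
  rw [h1, chart_fiberPoint hb, fiberCoords_joinCoords]

theorem contMDiff_fiberCoords_fiberPoint {Ψ Ψ' : HomogeneousChart m h (stdWeight d₀ d)}
    {b : C.Base} (hb : C.incl b ∈ Ψ.chart.source) (hb' : C.incl b ∈ Ψ'.chart.source) :
    ContMDiff 𝓘(ℝ, StdGradedSpace d) 𝓘(ℝ, StdGradedSpace d) ∞
      (fun v => fiberCoords (Ψ'.chart (fiberPoint Ψ C b v))) := by
  have hjoin : ContDiff ℝ ∞ (fun v : StdGradedSpace d =>
      joinCoords (baseCoords (Ψ.chart (C.incl b))) v) :=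
    contDiff_joinCoords.comp (contDiff_const.prodMk contDiff_id)
  exact contDiff_fiberCoords.contMDiff.comp (Ψ'.smooth.comp_contMDiff
    (Ψ.smooth_symm.comp_contMDiff hjoin.contMDiff fun v => joinCoords_chart_mem hb v)
    fun v => C.fiberPoint_mem_source' hb hb' v)

/-- The change of fiber coordinates over a point of the base. -/
def transition (Ψ Ψ' : HomogeneousChart m h (stdWeight d₀ d)) (b : C.Base)
    (hb : C.incl b ∈ Ψ.chart.source) (hb' : C.incl b ∈ Ψ'.chart.source) : StdGradedAut d where
  toDiffeo :=
    { toFun := fun v => fiberCoords (Ψ'.chart (fiberPoint Ψ C b v))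
      invFun := fun v => fiberCoords (Ψ.chart (fiberPoint Ψ' C b v))
      left_inv := fun v => C.fiberCoords_fiberPoint_leftInv hb hb' v
      right_inv := fun v => C.fiberCoords_fiberPoint_leftInv hb' hb v
      contMDiff_toFun := C.contMDiff_fiberCoords_fiberPoint hb hb'
      contMDiff_invFun := C.contMDiff_fiberCoords_fiberPoint hb' hb }
  map_homothety t v := by
    show fiberCoords (Ψ'.chart (fiberPoint Ψ C b (stdHomothety d t v))) =
      stdHomothety d t (fiberCoords (Ψ'.chart (fiberPoint Ψ C b v)))
    rw [fiberPoint_stdHomothety hb, Ψ'.map_act t _ (C.fiberPoint_mem_source' hb hb' v),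
      fiberCoords_weightedScale]

/-- The graded bundle defined by an atlas of homogeneous charts. -/
noncomputable def toGradedBundle [T2Space M] [SecondCountableTopology M] : GradedBundle n m M where
  baseDim := d₀
  Base := C.Base
  proj := C.proj
  smooth_proj := C.contMDiff_proj
  rank := d
  atlas := range C.trivialization
  covers b := by
    obtain ⟨Ψ, hΨ⟩ := C.exists_chart (C.incl b)
    exact ⟨_, mem_range_self Ψ, hΨ⟩
  smooth_triv := by
    rintro _ ⟨Ψ, rfl⟩
    exact C.contMDiffOn_trivialization Ψ
  smooth_triv_symm := by
    rintro _ ⟨Ψ, rfl⟩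
    exact C.contMDiffOn_trivialization_symm Ψ
  transition := by
    rintro _ ⟨Ψ, rfl⟩ _ ⟨Ψ', rfl⟩ b ⟨hb, hb'⟩
    refine ⟨C.transition Ψ Ψ' b hb hb', fun v => ?_⟩
    show (C.proj (fiberPoint Ψ C b v), fiberCoords (Ψ'.chart (fiberPoint Ψ C b v))) = _
    rw [proj_fiberPoint hb]
    rfl

theorem toGradedBundle_homothety [T2Space M] [SecondCountableTopology M] (t : ℝ≥0) (p : M) :
    C.toGradedBundle.homothety t p = h t p := by
  obtain ⟨⟨Ψ, hΨ⟩, hb⟩ := (C.toGradedBundle.covers (C.proj p)).choose_spec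
  have hp : p ∈ Ψ.chart.source := by
    rw [← hΨ] at hb
    exact incl_proj_mem_source.1 hb
  unfold GradedBundle.homothety
  show (C.toGradedBundle.covers (C.proj p)).choose.toOpenPartialHomeomorph.symm
    (C.proj p, stdHomothety d t ((C.toGradedBundle.covers (C.proj p)).choose p).2) = h t p
  rw [← hΨ]
  show fiberPoint Ψ C (C.proj p) (stdHomothety d t (fiberCoords (Ψ.chart p))) = h t p
  rw [fiberPoint_stdHomothety (incl_proj_mem_source.2 hp), fiberPoint_proj hp]

end HasGradedAtlas

end GradedAtlas

/-! ### Homogeneous charts of a graded bundle -/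

namespace GradedBundle

variable {n m : ℕ} {M : Type u} [TopologicalSpace M] [ChartedSpace (EuclideanSpace ℝ (Fin m)) M]
  (E : GradedBundle n m M)

theorem proj_homothety (t : ℝ≥0) (p : M) : E.proj (E.homothety t p) = E.proj p :=
  Bundle.Trivialization.proj_symm_apply' _ (E.covers (E.proj p)).choose_spec.2

theorem homothety_mul (t s : ℝ≥0) (p : M) :
    E.homothety (t * s) p = E.homothety t (E.homothety s p) := by
  obtain ⟨e, he, hp⟩ := E.covers (E.proj p)
  have hs : E.proj (E.homothety s p) ∈ e.baseSet := by rwa [E.proj_homothety]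
  refine e.injOn (e.mem_source.2 ?_) (e.mem_source.2 ?_) ?_
  · rwa [E.proj_homothety]
  · rwa [E.proj_homothety]
  · show e (E.homothety (t * s) p) = e (E.homothety t (E.homothety s p))
    rw [E.homothety_eq e he _ _ hp, E.homothety_eq e he _ _ hs, E.homothety_eq e he _ _ hp,
      E.proj_homothety]
    ext1
    · rfl
    · ext i
      simp [stdHomothety, mul_pow, mul_assoc]

section Chart

variable {E} (e : Bundle.Trivialization (StdGradedSpace E.rank) E.proj) (b : E.Base)

theorem contMDiffOn_joinCoords_triv (he : e ∈ E.atlas) : ContMDiffOn (𝓡 m)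
    𝓘(ℝ, Fin E.baseDim ⊕ (Σ r : Fin n, Fin (E.rank r)) → ℝ) ∞
    (fun p => joinCoords (chartAt (EuclideanSpace ℝ (Fin E.baseDim)) b (E.proj p)) (e p).2)
    (E.proj ⁻¹' (e.baseSet ∩ (chartAt (EuclideanSpace ℝ (Fin E.baseDim)) b).source)) := by
  have h1 : ContMDiffOn (𝓡 m) (𝓡 E.baseDim) ∞
      (fun p => chartAt (EuclideanSpace ℝ (Fin E.baseDim)) b (E.proj p))
      (E.proj ⁻¹' (e.baseSet ∩ (chartAt (EuclideanSpace ℝ (Fin E.baseDim)) b).source)) :=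
    (contMDiffOn_chart (I := 𝓡 E.baseDim)).comp E.smooth_proj.contMDiffOn fun p hp => hp.2
  have h2 := contMDiff_snd.comp_contMDiffOn ((E.smooth_triv e he).mono
    (fun p (hp : p ∈ E.proj ⁻¹' (e.baseSet ∩
      (chartAt (EuclideanSpace ℝ (Fin E.baseDim)) b).source)) => e.mem_source.2 hp.1))
  exact contDiff_joinCoords.contMDiff.comp_contMDiffOn (h1.prodMk_space h2)

theorem contMDiffOn_triv_symm_coords (he : e ∈ E.atlas) : ContMDiffOn
    𝓘(ℝ, Fin E.baseDim ⊕ (Σ r : Fin n, Fin (E.rank r)) → ℝ) (𝓡 m) ∞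
    (fun y => e.toOpenPartialHomeomorph.symm
      ((chartAt (EuclideanSpace ℝ (Fin E.baseDim)) b).symm (baseCoords y), fiberCoords y))
    (baseCoords ⁻¹' ((chartAt (EuclideanSpace ℝ (Fin E.baseDim)) b).target ∩
      (chartAt (EuclideanSpace ℝ (Fin E.baseDim)) b).symm ⁻¹' e.baseSet)) := by
  have h1 : ContMDiffOn 𝓘(ℝ, Fin E.baseDim ⊕ (Σ r : Fin n, Fin (E.rank r)) → ℝ) (𝓡 E.baseDim) ∞
      (fun y => (chartAt (EuclideanSpace ℝ (Fin E.baseDim)) b).symm (baseCoords y))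
      (baseCoords ⁻¹' ((chartAt (EuclideanSpace ℝ (Fin E.baseDim)) b).target ∩
        (chartAt (EuclideanSpace ℝ (Fin E.baseDim)) b).symm ⁻¹' e.baseSet)) :=
    (contMDiffOn_chart_symm (I := 𝓡 E.baseDim)).comp contDiff_baseCoords.contMDiff.contMDiffOn
      fun y hy => hy.1
  exact (E.smooth_triv_symm e he).comp
    (h1.prodMk contDiff_fiberCoords.contMDiff.contMDiffOn) fun y hy => e.mem_target.2 hy.2

end Chart

/-- The coordinates on the total space given by a chart of the base and a local trivialization. -/
def homogeneousChart (e : Bundle.Trivialization (StdGradedSpace E.rank) E.proj) (he : e ∈ E.atlas)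
    (b : E.Base) : HomogeneousChart m E.homothety (stdWeight E.baseDim E.rank) where
  chart :=
    { toFun := fun p => joinCoords (chartAt (EuclideanSpace ℝ (Fin E.baseDim)) b (E.proj p)) (e p).2
      invFun := fun y => e.toOpenPartialHomeomorph.symm
        ((chartAt (EuclideanSpace ℝ (Fin E.baseDim)) b).symm (baseCoords y), fiberCoords y)
      source := E.proj ⁻¹' (e.baseSet ∩ (chartAt (EuclideanSpace ℝ (Fin E.baseDim)) b).source)
      target := baseCoords ⁻¹' ((chartAt (EuclideanSpace ℝ (Fin E.baseDim)) b).target ∩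
        (chartAt (EuclideanSpace ℝ (Fin E.baseDim)) b).symm ⁻¹' e.baseSet)
      map_source' := by
        rintro p ⟨h1, h2⟩
        refine ⟨(chartAt _ b).map_source h2, ?_⟩
        rw [baseCoords_joinCoords, mem_preimage, (chartAt _ b).left_inv h2]
        exact h1
      map_target' := by
        rintro y ⟨h1, h2⟩
        rw [mem_preimage, e.proj_symm_apply' h2]
        exact ⟨h2, (chartAt _ b).map_target h1⟩
      left_inv' := by
        rintro p ⟨h1, h2⟩
        rw [baseCoords_joinCoords, fiberCoords_joinCoords, (chartAt _ b).left_inv h2,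
          e.symm_apply_mk_proj (e.mem_source.2 h1)]
      right_inv' := by
        rintro y ⟨h1, h2⟩
        rw [e.proj_symm_apply' h2, e.apply_symm_apply' h2, (chartAt _ b).right_inv h1,
          joinCoords_baseCoords_fiberCoords]
      open_source := (e.open_baseSet.inter (chartAt _ b).open_source).preimage
        E.smooth_proj.continuous
      open_target := ((chartAt _ b).isOpen_inter_preimage_symm e.open_baseSet).preimage
        contDiff_baseCoords.continuous
      continuousOn_toFun := (contMDiffOn_joinCoords_triv e b he).continuousOn
      continuousOn_invFun := (contMDiffOn_triv_symm_coords e b he).continuousOn }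
  smooth := contMDiffOn_joinCoords_triv e b he
  smooth_symm := contMDiffOn_triv_symm_coords e b he
  zero_mem_source p := by
    simp only [mem_preimage, E.proj_homothety]
  zero_mem_target y := by
    simp only [mem_preimage, baseCoords_weightedScale]
  map_act t p hp := by
    show joinCoords (chartAt _ b (E.proj (E.homothety t p))) (e (E.homothety t p)).2 =
      weightedScale _ t (joinCoords (chartAt _ b (E.proj p)) (e p).2)
    rw [weightedScale_joinCoords, E.proj_homothety, E.homothety_eq e he t p hp.1]

theorem isLocallyGraded : IsLocallyGraded m E.homothety where
  mul_act := E.homothety_mul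
  exists_chart p := by
    obtain ⟨e, he, hp⟩ := E.covers (E.proj p)
    exact ⟨_, inferInstance, _, E.homogeneousChart e he (E.proj p), hp, mem_chart_source _ _⟩

end GradedBundle

/-! ### Jets of orbits -/

section Jets

variable {m : ℕ} {M : Type u} [TopologicalSpace M] [ChartedSpace (EuclideanSpace ℝ (Fin m)) M]

theorem jetVanishes_const (n : ℕ) (q : M) : JetVanishes m n (fun _ : ℝ≥0 => q) := by
  intro i hi _
  simp only
  rw [iteratedDerivWithin_const, if_neg (by omega)]

theorem isLittleO_weightedScale_iff {ι : Type} [Fintype ι] (w : ι → ℕ) (n : ℕ) (y : ι → ℝ) :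
    (fun s => weightedScale w s y - weightedScale w 0 y) =o[𝓝[>] 0] (fun s : ℝ => s ^ n) ↔
      ∀ i, 1 ≤ w i → w i ≤ n → y i = 0 := by
  rw [isLittleO_pi]
  refine forall_congr' fun i => ?_
  simp only [Pi.sub_apply, weightedScale_apply]
  constructor
  · intro h h1 hn
    rw [zero_pow (by omega)] at h
    refine eq_zero_of_const_smul_pow_isLittleO (n := w i) ?_
    refine (h.trans_isBigO (IsBigO.of_bound 1 ?_)).congr_left fun s => by simp
    have : ∀ᶠ s : ℝ in 𝓝[>] 0, s < 1 := nhdsWithin_le_nhds (Iio_mem_nhds one_pos)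
    filter_upwards [this, self_mem_nhdsWithin] with s hs hs0
    have hs0 : 0 < s := hs0
    rw [one_mul, Real.norm_of_nonneg (by positivity), Real.norm_of_nonneg (by positivity)]
    exact pow_le_pow_of_le_one hs0.le hs.le hn
  · intro h
    rcases Nat.eq_zero_or_pos (w i) with h0 | h0
    · simp [h0]
    · rcases le_or_gt (w i) n with hn | hn
      · simp [h h0 hn]
      · simp only [zero_pow h0.ne', zero_mul, sub_zero]
        have h1 : (fun s : ℝ => s ^ w i) =o[𝓝 0] fun s : ℝ => s ^ n := isLittleO_pow_pow hn
        have h2 := (h1.mono (nhdsWithin_le_nhds (s := Ioi 0))).const_mul_left (y i)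
        exact h2.congr_left fun s => mul_comm _ _

/-- In a homogeneous chart the `n`-jet of an orbit consists of the coordinates of weights
`1, …, n`. -/
theorem HomogeneousChart.jetVanishes_iff [IsManifold (𝓡 m) ∞ M] {h : ℝ≥0 → M → M}
    (hmul : ∀ (t s : ℝ≥0) (p : M), h (t * s) p = h t (h s p)) {ι : Type} [Fintype ι] {w : ι → ℕ}
    (Ψ : HomogeneousChart m h w) {p : M} (hp : p ∈ Ψ.chart.source) (n : ℕ) :
    JetVanishes m n (fun t => h t p) ↔ ∀ i, 1 ≤ w i → w i ≤ n → Ψ.chart p i = 0 := by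
  set φ := chartAt (EuclideanSpace ℝ (Fin m)) (h 0 p) with hφ
  set c : ℝ → M := fun s => Ψ.scale s p with hc
  have hcs : ContMDiff 𝓘(ℝ, ℝ) (𝓡 m) ∞ c := contMDiff_scale_left hp
  have hc0 : c 0 = h 0 p := by
    have := scale_coe hmul 0 hp
    rwa [NNReal.coe_zero] at this
  have hc0φ : c 0 ∈ φ.source := by rw [hc0]; exact mem_chart_source _ _
  have hφc : ContDiffAt ℝ ∞ (fun s => φ (c s)) 0 :=
    (ContMDiffAt.comp (0 : ℝ) ((contMDiffOn_chart (I := 𝓡 m)).contMDiffAt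
      (φ.open_source.mem_nhds hc0φ)) hcs.contMDiffAt).contDiffAt
  have hjet : JetVanishes m n (fun t => h t p) ↔
      ∀ i, 1 ≤ i → i ≤ n → iteratedDeriv i (fun s => φ (c s)) 0 = 0 := by
    refine forall_congr' fun i => imp_congr_right fun _ => imp_congr_right fun _ => ?_
    have h1 : EqOn (fun s : ℝ => φ (h s.toNNReal p)) (fun s => φ (c s)) (Ici 0) := by
      intro s hs
      simp only [hc]
      lift s to ℝ≥0 using hs
      rw [scale_coe hmul s hp, Real.toNNReal_coe]
    rw [← iteratedDerivWithin_eq_iteratedDeriv (uniqueDiffOn_Ici 0)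
      (hφc.of_le (by exact_mod_cast le_top)) self_mem_Ici,
      ← iteratedDerivWithin_congr h1 self_mem_Ici]
  rw [hjet, iteratedDeriv_eq_zero_iff_isLittleO hφc, ← isLittleO_weightedScale_iff]
  -- the curve read in two charts; the transition map and its inverse are differentiable at `c 0`
  have hcΨ : ∀ s, c s ∈ Ψ.chart.source := fun s => scale_mem_source s hp
  have hΨc : ∀ s, Ψ.chart (c s) = weightedScale w s (Ψ.chart p) := fun s => chart_scale s hp
  simp only [← hΨc]
  have hcφ : ∀ᶠ s in 𝓝[>] (0 : ℝ), c s ∈ φ.source :=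
    (hcs.continuous.continuousAt.eventually (φ.open_source.mem_nhds hc0φ)).filter_mono
      nhdsWithin_le_nhds
  constructor
  · intro ho
    have hd : DifferentiableAt ℝ (fun u => Ψ.chart (φ.symm u)) (φ (c 0)) := by
      have : ContMDiffAt 𝓘(ℝ, EuclideanSpace ℝ (Fin m)) 𝓘(ℝ, ι → ℝ) ∞
          (fun u => Ψ.chart (φ.symm u)) (φ (c 0)) :=
        ContMDiffAt.comp (I' := 𝓡 m) (φ (c 0))
          (Ψ.smooth.contMDiffAt (Ψ.chart.open_source.mem_nhds
            (by rw [φ.left_inv hc0φ]; exact hcΨ 0)))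
          ((contMDiffOn_chart_symm (I := 𝓡 m)).contMDiffAt
            (φ.open_target.mem_nhds (φ.map_source hc0φ)))
      exact this.contDiffAt.differentiableAt (by simp)
    have hO := hd.hasFDerivAt.isBigO_sub.comp_tendsto
      (hφc.continuousAt.tendsto.mono_left (nhdsWithin_le_nhds (s := Ioi 0)))
    refine IsBigO.trans_isLittleO (hO.congr' ?_ EventuallyEq.rfl) ho
    filter_upwards [hcφ] with s hs
    simp only [Function.comp_apply, φ.left_inv hs, φ.left_inv hc0φ]
  · intro ho
    have hd : DifferentiableAt ℝ (fun y => φ (Ψ.chart.symm y)) (Ψ.chart (c 0)) := by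
      have : ContMDiffAt 𝓘(ℝ, ι → ℝ) 𝓘(ℝ, EuclideanSpace ℝ (Fin m)) ∞
          (fun y => φ (Ψ.chart.symm y)) (Ψ.chart (c 0)) :=
        ContMDiffAt.comp (I' := 𝓡 m) (Ψ.chart (c 0))
          ((contMDiffOn_chart (I := 𝓡 m)).contMDiffAt (φ.open_source.mem_nhds
            (by rw [Ψ.chart.left_inv (hcΨ 0)]; exact hc0φ)))
          (Ψ.smooth_symm.contMDiffAt
            (Ψ.chart.open_target.mem_nhds (Ψ.chart.map_source (hcΨ 0))))
      exact this.contDiffAt.differentiableAt (by simp)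
    have hct : ContinuousAt (fun s => Ψ.chart (c s)) 0 := by
      simp only [hΨc]
      exact (contDiff_weightedScale_left w _).continuous.continuousAt
    have hO := hd.hasFDerivAt.isBigO_sub.comp_tendsto
      (hct.tendsto.mono_left (nhdsWithin_le_nhds (s := Ioi 0)))
    refine IsBigO.trans_isLittleO (hO.congr' ?_ EventuallyEq.rfl) ho
    filter_upwards with s
    simp only [Function.comp_apply, Ψ.chart.left_inv (hcΨ _)]

end Jets

/-! ### Smooth idempotent maps -/

section Idempotent

variable {E : Type*} [NormedAddCommGroup E] [NormedSpace ℝ E] [CompleteSpace E]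

/-- A smooth idempotent map whose differential at a fixed point is the identity is the identity near
that point, as it is locally injective. -/
theorem eventually_eq_of_idempotent_of_fderiv_eq_id {F : E → E} {N : Set E} (hN : IsOpen N)
    (hF : ContDiffOn ℝ ∞ F N) {u₀ : E} (hu₀ : u₀ ∈ N) (hfix : F u₀ = u₀)
    (hidem : ∀ᶠ u in 𝓝 u₀, F (F u) = F u)
    (hD : fderiv ℝ F u₀ = ContinuousLinearMap.id ℝ E) : ∀ᶠ u in 𝓝 u₀, F u = u := by
  have hat := hF.contDiffAt (hN.mem_nhds hu₀)
  have hd : HasFDerivAt F ((ContinuousLinearEquiv.refl ℝ E : E ≃L[ℝ] E) : E →L[ℝ] E) u₀ := by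
    have := (hat.differentiableAt (by simp)).hasFDerivAt
    rw [hD] at this
    exact this
  obtain ⟨Θ, hΘ, -, hΘF, -⟩ := exists_smooth_local_inverse hN hF hu₀ hd
  have h1 : ∀ᶠ u in 𝓝 u₀, F u ∈ Θ.source :=
    hat.continuousAt.eventually (Θ.open_source.mem_nhds (by rw [hfix]; exact hΘ))
  filter_upwards [h1, hidem, Θ.open_source.mem_nhds hΘ] with u hu1 hu2 hu3
  exact Θ.injOn hu1 hu3 (by rw [hΘF, hΘF, hu2])

/-- The differential `D` of a smooth idempotent map `F` at an isolated point of a fiber is the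
identity: `D ∘ F + (1 - D) ∘ (1 - F)` is a local diffeomorphism which conjugates `F` to the linear
projection `D`, so that `D` is injective. -/
theorem fderiv_eq_id_of_idempotent_of_isolated {F : E → E} {N : Set E} (hN : IsOpen N)
    (hF : ContDiffOn ℝ ∞ F N) {u₀ : E} (hu₀ : u₀ ∈ N) (hfix : F u₀ = u₀)
    (hidem : ∀ᶠ u in 𝓝 u₀, F (F u) = F u) (hiso : ∀ᶠ u in 𝓝 u₀, F u = u₀ → u = u₀) :
    fderiv ℝ F u₀ = ContinuousLinearMap.id ℝ E := by
  set D := fderiv ℝ F u₀ with hDdef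
  have hat := hF.contDiffAt (hN.mem_nhds hu₀)
  have hd : HasFDerivAt F D u₀ := (hat.differentiableAt (by simp)).hasFDerivAt
  have hDD : ∀ v, D (D v) = D v := by
    have h1 : HasFDerivAt F D (F u₀) := by rw [hfix]; exact hd
    have h2 := (h1.comp u₀ hd).unique (hd.congr_of_eventuallyEq hidem)
    exact fun v => congrArg (fun T => T v) h2
  let Φ : E → E := fun u => D (F u) + ((u - F u) - D (u - F u))
  have hΦ : ContDiffOn ℝ ∞ Φ N :=
    (D.contDiff.comp_contDiffOn hF).add
      ((contDiffOn_id.sub hF).sub (D.contDiff.comp_contDiffOn (contDiffOn_id.sub hF)))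
  have hdΦ : HasFDerivAt Φ ((ContinuousLinearEquiv.refl ℝ E : E ≃L[ℝ] E) : E →L[ℝ] E) u₀ := by
    have h1 : HasFDerivAt (fun u => u - F u) (ContinuousLinearMap.id ℝ E - D) u₀ :=
      (hasFDerivAt_id u₀).sub hd
    refine ((D.hasFDerivAt.comp u₀ hd).add (h1.sub (D.hasFDerivAt.comp u₀ h1))).congr_fderiv ?_
    ext v
    simp [hDD]
  obtain ⟨Θ, hΘ, -, hΘΦ, -⟩ := exists_smooth_local_inverse hN hΦ hu₀ hdΦ
  have hΦF : ∀ u, F (F u) = F u → Φ (F u) = D (Φ u) := by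
    intro u hu
    simp [Φ, hu, hDD]
  have hker : ∀ v, D v = 0 → v = 0 := by
    intro v hv
    have hcont : Tendsto (fun r : ℝ => Θ.symm (Θ u₀ + r • v)) (𝓝 0) (𝓝 u₀) := by
      have h1 : Tendsto (fun r : ℝ => Θ u₀ + r • v) (𝓝 0) (𝓝 (Θ u₀)) := by
        have : Continuous (fun r : ℝ => Θ u₀ + r • v) := by fun_prop
        simpa using this.tendsto 0
      have h2 := (Θ.continuousAt_symm (Θ.map_source hΘ)).tendsto.comp h1
      rwa [Θ.left_inv hΘ] at h2
    have h0 : ∀ᶠ r in 𝓝 (0 : ℝ), Θ u₀ + r • v ∈ Θ.target := by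
      have : Continuous (fun r : ℝ => Θ u₀ + r • v) := by fun_prop
      exact this.continuousAt.eventually
        (Θ.open_target.mem_nhds (by simpa using Θ.map_source hΘ))
    have h1 : ∀ᶠ u in 𝓝 u₀, F u ∈ Θ.source :=
      hat.continuousAt.eventually (Θ.open_source.mem_nhds (by rw [hfix]; exact hΘ))
    obtain ⟨r, ⟨⟨hr0, hr1, hr2, hr3⟩, hr⟩⟩ :=
      ((((h0.and (hcont.eventually (h1.and (hidem.and hiso))))).filter_mono
        (nhdsWithin_le_nhds (s := {0}ᶜ))).and self_mem_nhdsWithin).exists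
    set u := Θ.symm (Θ u₀ + r • v) with hu
    have e1 : Φ u = Θ u₀ + r • v := by rw [← hΘΦ, hu, Θ.right_inv hr0]
    have e2 : Θ (F u) = Θ u₀ := by
      have e3 : Φ u₀ = D u₀ := by simp [Φ, hfix]
      rw [hΘΦ, hΦF u hr2, e1, hΘΦ, e3, map_add, map_smul, hv, hDD]
      simp
    have e3 : u = u₀ := hr3 (Θ.injOn hr1 hΘ e2)
    rw [e3, ← hΘΦ] at e1
    have e4 : r • v = 0 := by simpa using e1
    exact (smul_eq_zero.1 e4).resolve_left hr
  ext v
  have := hker (D v - v) (by rw [map_sub, hDD, sub_self])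
  simpa [sub_eq_zero] using this

end Idempotent

section IdempotentManifold

variable {m : ℕ} {M : Type u} [TopologicalSpace M] [ChartedSpace (EuclideanSpace ℝ (Fin m)) M]
  [IsManifold (𝓡 m) ∞ M]

theorem contDiffOn_map_in_charts {f : M → M} (hf : ContMDiff (𝓡 m) (𝓡 m) ∞ f) (q : M) :
    IsOpen ((chartAt (EuclideanSpace ℝ (Fin m)) q).target ∩
      (fun u => f ((chartAt (EuclideanSpace ℝ (Fin m)) q).symm u)) ⁻¹'
        (chartAt (EuclideanSpace ℝ (Fin m)) q).source) ∧
    ContDiffOn ℝ ∞ (fun u => chartAt (EuclideanSpace ℝ (Fin m)) q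
        (f ((chartAt (EuclideanSpace ℝ (Fin m)) q).symm u)))
      ((chartAt (EuclideanSpace ℝ (Fin m)) q).target ∩
        (fun u => f ((chartAt (EuclideanSpace ℝ (Fin m)) q).symm u)) ⁻¹'
          (chartAt (EuclideanSpace ℝ (Fin m)) q).source) := by
  set φ := chartAt (EuclideanSpace ℝ (Fin m)) q
  have h1 : ContMDiffOn 𝓘(ℝ, EuclideanSpace ℝ (Fin m)) (𝓡 m) ∞ (fun u => f (φ.symm u)) φ.target :=
    hf.comp_contMDiffOn (contMDiffOn_chart_symm (I := 𝓡 m) (x := q))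
  refine ⟨h1.continuousOn.isOpen_inter_preimage φ.open_target φ.open_source, ?_⟩
  rw [← contMDiffOn_iff_contDiffOn]
  exact (contMDiffOn_chart (I := 𝓡 m) (x := q)).comp (h1.mono inter_subset_left) fun x hx => hx.2

/-- A smooth idempotent map of a connected manifold with an isolated point in a fiber is the
identity: the set of points near which it is the identity is open and closed. -/
theorem eq_id_of_idempotent_of_isolated [T2Space M] [ConnectedSpace M] {f : M → M}
    (hf : ContMDiff (𝓡 m) (𝓡 m) ∞ f) (hidem : ∀ p, f (f p) = f p) {q : M} (hq : f q = q)
    (hiso : ∀ p, f p = q → p = q) (p : M) : f p = p := by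
  have hchart : ∀ q, f q = q →
      chartAt (EuclideanSpace ℝ (Fin m)) q q ∈ (chartAt (EuclideanSpace ℝ (Fin m)) q).target ∩
        (fun u => f ((chartAt (EuclideanSpace ℝ (Fin m)) q).symm u)) ⁻¹'
          (chartAt (EuclideanSpace ℝ (Fin m)) q).source := by
    intro q hq
    refine ⟨mem_chart_target _ q, ?_⟩
    rw [mem_preimage, OpenPartialHomeomorph.left_inv _ (mem_chart_source _ q), hq]
    exact mem_chart_source _ q
  have hidem' : ∀ q, f q = q → ∀ᶠ u in 𝓝 (chartAt (EuclideanSpace ℝ (Fin m)) q q),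
      (fun u => chartAt (EuclideanSpace ℝ (Fin m)) q
        (f ((chartAt (EuclideanSpace ℝ (Fin m)) q).symm u))) ((fun u =>
          chartAt (EuclideanSpace ℝ (Fin m)) q
            (f ((chartAt (EuclideanSpace ℝ (Fin m)) q).symm u))) u) =
        chartAt (EuclideanSpace ℝ (Fin m)) q
          (f ((chartAt (EuclideanSpace ℝ (Fin m)) q).symm u)) := by
    intro q hq
    filter_upwards [(contDiffOn_map_in_charts hf q).1.mem_nhds (hchart q hq)] with u hu
    simp only [OpenPartialHomeomorph.left_inv _ hu.2, hidem]
  have hfixed : ∀ q, f q = q → chartAt (EuclideanSpace ℝ (Fin m)) q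
      (f ((chartAt (EuclideanSpace ℝ (Fin m)) q).symm (chartAt _ q q))) = chartAt _ q q := by
    intro q hq
    rw [OpenPartialHomeomorph.left_inv _ (mem_chart_source _ q), hq]
  have key : ∀ q, f q = q → fderiv ℝ (fun u => chartAt (EuclideanSpace ℝ (Fin m)) q
      (f ((chartAt (EuclideanSpace ℝ (Fin m)) q).symm u))) (chartAt _ q q) =
        ContinuousLinearMap.id ℝ _ → ∀ᶠ x in 𝓝 q, f x = x := by
    intro q hq hD
    have h1 := eventually_eq_of_idempotent_of_fderiv_eq_id (contDiffOn_map_in_charts hf q).1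
      (contDiffOn_map_in_charts hf q).2 (hchart q hq) (hfixed q hq) (hidem' q hq) hD
    have hs := mem_chart_source (EuclideanSpace ℝ (Fin m)) q
    have h2 := ((chartAt (EuclideanSpace ℝ (Fin m)) q).continuousAt hs).eventually h1
    have h3 : ∀ᶠ x in 𝓝 q, f x ∈ (chartAt (EuclideanSpace ℝ (Fin m)) q).source :=
      hf.continuous.continuousAt.eventually
        ((chartAt (EuclideanSpace ℝ (Fin m)) q).open_source.mem_nhds (by rw [hq]; exact hs))
    filter_upwards [h2, h3, (chartAt (EuclideanSpace ℝ (Fin m)) q).open_source.mem_nhds hs]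
      with x hx1 hx2 hx3
    rw [OpenPartialHomeomorph.left_inv _ hx3] at hx1
    exact OpenPartialHomeomorph.injOn _ hx2 hx3 hx1
  set S : Set M := {q | ∀ᶠ x in 𝓝 q, f x = x} with hS
  have hSfix : ∀ q ∈ S, f q = q := fun q hq =>
    Eventually.self_of_nhds (p := fun x => f x = x) hq
  have hSo : IsOpen S := isOpen_iff_eventually.2 fun q hq => eventually_eventually_nhds.2 hq
  have hSc : IsClosed S := by
    refine isClosed_of_closure_subset fun q hq => ?_
    have hfq : f q = q :=
      closure_minimal (t := {x | f x = x}) hSfix (isClosed_eq hf.continuous continuous_id) hq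
    refine key q hfq ?_
    by_contra hne
    set φ := chartAt (EuclideanSpace ℝ (Fin m)) q with hφ
    have hs : q ∈ φ.source := mem_chart_source (EuclideanSpace ℝ (Fin m)) q
    have hcont : ContinuousAt (fun x => fderiv ℝ (fun u => φ (f (φ.symm u))) (φ x)) q :=
      ContinuousAt.comp (((contDiffOn_map_in_charts hf q).2.continuousOn_fderiv_of_isOpen
        (contDiffOn_map_in_charts hf q).1 (by simp)).continuousAt
          ((contDiffOn_map_in_charts hf q).1.mem_nhds (hchart q hfq))) (φ.continuousAt hs)
    obtain ⟨x, hxS, hx1, hx2⟩ := ((mem_closure_iff_frequently.1 hq).and_eventually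
      ((hcont.eventually_ne hne).and (φ.open_source.mem_nhds hs))).exists
    refine hx1 ((((hasFDerivAt_id (φ x)).congr_of_eventuallyEq ?_)).fderiv)
    have h1 : ContinuousAt φ.symm (φ x) := φ.continuousAt_symm (φ.map_source hx2)
    have h2 : ∀ᶠ y in 𝓝 (φ.symm (φ x)), f y = y := by rw [φ.left_inv hx2]; exact hxS
    filter_upwards [h1.eventually h2, φ.open_target.mem_nhds (φ.map_source hx2)] with u hu hut
    rw [hu, φ.right_inv hut, id]
  have hqS : q ∈ S := by
    refine key q hq (fderiv_eq_id_of_idempotent_of_isolated (contDiffOn_map_in_charts hf q).1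
      (contDiffOn_map_in_charts hf q).2 (hchart q hq) (hfixed q hq) (hidem' q hq) ?_)
    filter_upwards [(contDiffOn_map_in_charts hf q).1.mem_nhds (hchart q hq)] with u hu he
    have h1 : f ((chartAt (EuclideanSpace ℝ (Fin m)) q).symm u) = q :=
      OpenPartialHomeomorph.injOn _ hu.2 (mem_chart_source _ q) he
    exact (OpenPartialHomeomorph.right_inv _ hu.1).symm.trans (congrArg _ (hiso _ h1))
  have hSu : S = univ := IsClopen.eq_univ ⟨hSc, hSo⟩ ⟨q, hqS⟩
  exact hSfix p (hSu ▸ mem_univ p)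

end IdempotentManifold

/-! ### Homogeneity structures -/

section HomogeneityStructure

variable {m : ℕ} {M : Type u} [TopologicalSpace M] [ChartedSpace (EuclideanSpace ℝ (Fin m)) M]

theorem IsSmoothSemigroupAction.contMDiff_act {h : ℝ≥0 → M → M} (hh : IsSmoothSemigroupAction m h)
    (t : ℝ≥0) : ContMDiff (𝓡 m) (𝓡 m) ∞ (h t) := by
  obtain ⟨ε, hε, H, hH, he⟩ := hh.smooth
  have h1 : ContMDiff (𝓡 m) (𝓡 m) ∞ (fun p => H ((t : ℝ), p)) :=
    hH.comp_contMDiff (contMDiff_const.prodMk contMDiff_id) fun p =>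
      ⟨lt_of_lt_of_le (neg_lt_zero.2 hε) t.coe_nonneg, mem_univ _⟩
  exact h1.congr fun p => (he t p).symm

variable [IsManifold (𝓡 m) ∞ M]

/-- In a homogeneity structure, `h 0 (M)` contains with a point its whole fiber under `h 1`, as the
orbits of the points of this fiber are constant. Hence these fibers are single points. -/
theorem IsHomogeneityStructure.one_act [T2Space M] [ConnectedSpace M] {n : ℕ} {h : ℝ≥0 → M → M}
    (hh : IsHomogeneityStructure m n h) (p : M) : h 1 p = p := by
  have hmul := hh.action.mul_act
  have hrange : ∀ q ∈ range (h 0), ∀ t, h t q = q := by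
    rintro _ ⟨p, rfl⟩ t
    rw [← hmul, mul_zero]
  obtain ⟨p₀⟩ := (inferInstance : Nonempty M)
  refine eq_id_of_idempotent_of_isolated (hh.action.contMDiff_act 1)
    (fun p => by rw [← hmul, one_mul]) (hrange (h 0 p₀) ⟨p₀, rfl⟩ 1) (fun p hp => ?_) p
  have h1 : ∀ t, h t p = h 0 p₀ := fun t => by
    rw [← mul_one t, hmul, hp, hrange _ ⟨p₀, rfl⟩]
  have h2 : p ∈ range (h 0) := (hh.nondegenerate p).1 (by
    simp only [h1]
    exact jetVanishes_const n _)
  rw [← hp, hrange p h2]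

/-- The orbit of a point has vanishing jet of an order which bounds all weights only if the point lies
in the zero section of a homogeneous chart. -/
theorem IsLocallyGraded.isHomogeneityStructure [ConnectedSpace M] {h : ℝ≥0 → M → M}
    (hM : IsLocallyGraded m h) (hh : IsSmoothSemigroupAction m h) :
    ∃ n : ℕ, 1 ≤ n ∧ IsHomogeneityStructure m n h := by
  obtain ⟨S, hS⟩ := hM.exists_weightMultiset
  -- the sum of the weights bounds each of them; the summand `1` makes the degree positive
  refine ⟨S.sum + 1, by omega, hh, fun p => ⟨fun hj => ?_, ?_⟩⟩
  · obtain ⟨ι, _, w, Ψ, hp⟩ := hM.exists_chart p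
    rw [Ψ.jetVanishes_iff hM.mul_act hp] at hj
    refine ⟨p, Ψ.chart.injOn ((Ψ.zero_mem_source p).2 hp) hp ?_⟩
    rw [Ψ.map_act 0 p hp, NNReal.coe_zero]
    ext i
    rw [weightedScale_apply]
    rcases Nat.eq_zero_or_pos (w i) with h0 | h0
    · simp [h0]
    · have hle : w i ≤ S.sum := by
        rw [← hS ι w Ψ p hp]
        exact Multiset.single_le_sum (fun _ _ => Nat.zero_le _) _
          (Multiset.mem_map_of_mem w (Finset.mem_univ i))
      rw [hj i h0 (by omega), mul_zero]
  · rintro ⟨q, rfl⟩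
    have h1 : ∀ t, h t (h 0 q) = h 0 q := fun t => by rw [← hM.mul_act, mul_zero]
    simp only [h1]
    exact jetVanishes_const _ _

/-- The weights of a homogeneity structure of degree `n` are at most `n`: a point on a coordinate
axis of higher weight has an orbit with vanishing `n`-jet. -/
theorem HomogeneousChart.weight_le {n : ℕ} {h : ℝ≥0 → M → M} (hh : IsHomogeneityStructure m n h)
    {ι : Type} [Fintype ι] {w : ι → ℕ} (Ψ : HomogeneousChart m h w) {p : M}
    (hp : p ∈ Ψ.chart.source) (a : ι) : w a ≤ n := by
  classical
  by_contra hlt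
  -- the point on the coordinate axis `a` over the fixed point `h 0 p`
  set y : ι → ℝ := weightedScale w 0 (Ψ.chart p) + Pi.single a 1 with hy
  have hwa : w a ≠ 0 := by omega
  have hy0 : weightedScale w 0 y = weightedScale w 0 (Ψ.chart p) := by
    ext i
    rcases eq_or_ne i a with rfl | hi
    · simp [hwa]
    · rcases Nat.eq_zero_or_pos (w i) with h0 | h0
      · simp [hy, hi, h0]
      · simp [h0.ne']
  have hyt : y ∈ Ψ.chart.target := by
    rw [← Ψ.zero_mem_target, hy0]
    exact weightedScale_chart_mem 0 hp
  have hys := Ψ.chart.map_target hyt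
  have hj : JetVanishes m n (fun t => h t (Ψ.chart.symm y)) := by
    rw [Ψ.jetVanishes_iff hh.action.mul_act hys, Ψ.chart.right_inv hyt]
    intro i h1 hn
    have hia : i ≠ a := by rintro rfl; omega
    simp [hy, hia, show w i ≠ 0 by omega]
  obtain ⟨q, hq⟩ := (hh.nondegenerate _).1 hj
  have hfix : h 0 (Ψ.chart.symm y) = Ψ.chart.symm y := by
    rw [← hq, ← hh.action.mul_act, mul_zero]
  have h1 := Ψ.map_act 0 _ hys
  rw [hfix, Ψ.chart.right_inv hyt, NNReal.coe_zero] at h1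
  have h2 := congrFun h1 a
  simp [hy, hwa] at h2

theorem IsHomogeneityStructure.exists_gradedBundle [T2Space M] [SecondCountableTopology M]
    [ConnectedSpace M] {n : ℕ} {h : ℝ≥0 → M → M} (hh : IsHomogeneityStructure m n h) :
    ∃ E : GradedBundle n m M, ∀ (t : ℝ≥0) (p : M), E.homothety t p = h t p := by
  have hM := hh.action.isLocallyGraded hh.one_act
  obtain ⟨S, hS⟩ := hM.exists_weightMultiset
  have C : HasGradedAtlas m h (S.count 0) fun r : Fin n => S.count ((r : ℕ) + 1) := by
    refine ⟨hM.mul_act, fun p => ?_⟩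
    obtain ⟨ι, _, w, Ψ, hp⟩ := hM.exists_chart p
    obtain ⟨σ, hσ⟩ := exists_equiv_stdWeight (hS ι w Ψ p hp) (Ψ.weight_le hh hp)
    rw [← hσ]
    exact ⟨Ψ.reindex σ, hp⟩
  exact ⟨C.toGradedBundle, C.toGradedBundle_homothety⟩

end HomogeneityStructure

/-! ### The equivalence of categories -/

open CategoryTheory

namespace GradedBundleCat

/-- The extension to `(ℝ, ·)` of the homotheties of a graded bundle. -/
noncomputable def act (X : GradedBundleCat.{u}) : ℝ → X.Carrier → X.Carrier :=
  X.bundle.isLocallyGraded.exists_real_action.choose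

theorem isSmoothRealAction_act (X : GradedBundleCat.{u}) : IsSmoothRealAction X.dim X.act :=
  X.bundle.isLocallyGraded.exists_real_action.choose_spec.1

theorem act_coe (X : GradedBundleCat.{u}) (t : ℝ≥0) (p : X.Carrier) :
    X.act t p = X.bundle.homothety t p :=
  X.bundle.isLocallyGraded.exists_real_action.choose_spec.2 t p

/-- The functor which extends the homotheties of graded bundles to actions of `(ℝ, ·)`. -/
noncomputable def toRealActionManifold : GradedBundleCat.{u} ⥤ RealActionManifold.{u} where
  obj X :=
    { dim := X.dim
      Carrier := X.Carrier
      act := X.act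
      isSmoothRealAction := X.isSmoothRealAction_act }
  map {X Y} f :=
    { toFun := Hom.toFun f
      smooth := Hom.smooth f
      map_act := X.isSmoothRealAction_act.map_act_of_map_homothety Y.bundle.isLocallyGraded
        Y.isSmoothRealAction_act Y.act_coe (Hom.smooth f) fun t p => by
          rw [X.act_coe]; exact Hom.map_homothety f t p }
  map_id _ := rfl
  map_comp _ _ := rfl

theorem extendsHomotheties_toRealActionManifold :
    ExtendsHomotheties toRealActionManifold.{u} :=
  ⟨fun X => Diffeomorph.refl (𝓡 X.dim) X.Carrier ∞, fun X t p => (X.act_coe t p).symm,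
    fun _ _ _ _ => rfl⟩

instance : toRealActionManifold.{u}.Faithful where
  map_injective hfg := Hom.ext (congrArg RealActionManifold.Hom.toFun hfg)

instance : toRealActionManifold.{u}.Full where
  map_surjective {X Y} f :=
    ⟨⟨f.toFun, f.smooth, fun t p => (congrArg f.toFun (X.act_coe t p)).symm.trans
      ((f.map_act t p).trans (Y.act_coe t (f.toFun p)))⟩, rfl⟩

/-- The restriction to `(ℝ≥0, ·)` of an action of `(ℝ, ·)` is the family of homotheties of a graded
bundle, and this family has only one extension. -/
instance : toRealActionManifold.{u}.EssSurj where
  mem_essImage Y := by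
    have hact := Y.isSmoothRealAction.isSmoothSemigroupAction
    have hone : ∀ p, Y.act (1 : ℝ≥0) p = p := by simpa using Y.isSmoothRealAction.one_act
    obtain ⟨n, -, hn⟩ := (hact.isLocallyGraded hone).isHomogeneityStructure hact
    obtain ⟨E, hE⟩ := hn.exists_gradedBundle
    let X : GradedBundleCat.{u} := { dim := Y.dim, Carrier := Y.Carrier, degree := n, bundle := E }
    have hXY : ∀ (t : ℝ) (p : Y.Carrier), X.act t p = Y.act t p := by
      intro t p
      exact X.isSmoothRealAction_act.map_act_of_map_homothety (hact.isLocallyGraded hone)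
        Y.isSmoothRealAction (fun _ _ => rfl) contMDiff_id
        (fun t p => (X.act_coe t p).trans (hE t p)) t p
    exact ⟨X, ⟨{ hom := ⟨id, contMDiff_id, hXY⟩
                 inv := ⟨id, contMDiff_id, fun t p => (hXY t p).symm⟩
                 hom_inv_id := rfl
                 inv_hom_id := rfl }⟩⟩

end GradedBundleCat

theorem mainTheorem2 :
    (∀ (m : ℕ) (M : Type u) [TopologicalSpace M] [ChartedSpace (EuclideanSpace ℝ (Fin m)) M]
        [IsManifold (𝓡 m) ∞ M] [T2Space M] [SecondCountableTopology M] [ConnectedSpace M]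
        (h : ℝ≥0 → M → M), IsSmoothSemigroupAction m h →
      ((∃ n : ℕ, 1 ≤ n ∧ IsHomogeneityStructure m n h) ↔ ∀ p : M, h 1 p = p) ∧
      (∀ n : ℕ, 1 ≤ n → IsHomogeneityStructure m n h →
        ∃ E : GradedBundle n m M, ∀ (t : ℝ≥0) (p : M), E.homothety t p = h t p) ∧
      ((∀ p : M, h 1 p = p) →
        ∃! H : ℝ → M → M, IsSmoothRealAction m H ∧ ∀ (t : ℝ≥0) (p : M), H (t : ℝ) p = h t p)) ∧
    (∃ F : CategoryTheory.Functor GradedBundleCat.{u} RealActionManifold.{u},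
      ExtendsHomotheties F ∧ F.IsEquivalence) := by
  refine ⟨?_, GradedBundleCat.toRealActionManifold,
    GradedBundleCat.extendsHomotheties_toRealActionManifold, {}⟩
  intro m M _ _ _ _ _ _ h hh
  refine ⟨⟨?_, fun hone => (hh.isLocallyGraded hone).isHomogeneityStructure hh⟩,
    fun n _ hn => hn.exists_gradedBundle, fun hone =>
      (hh.isLocallyGraded hone).existsUnique_real_action⟩
  rintro ⟨n, -, hn⟩
  exact hn.one_act
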